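/- For $n\ge 1$ let $e_1,\dots,e_n$ be the standard orthonormal basis of $\mathbb{R}^n$. Let $C_n$ be the group generated by the orthogonal reflections of $\mathbb{R}^n$ with roots $e_i$ $(1\le i\le n)$ and $e_i\pm e_j$ $(i\ne j)$; this is the group of signed coordinate permutations, i.e. the symmetry group of the $n$-cube, of order $2^n n!$. Let $D_n$ be the group generated by the reflections with roots $e_i\pm e_j$ $(i\neq j)$; this is the group of signed coordinate permutations with an even number of sign changes, of order $2^{n-1}n!$. Let $A_n$ be the group generated by the reflections of $\mathbb{R}^{n+1}$ with roots $e_i-e_j$ $(i\ne j)$; it is isomorphic to the symmetric group $\mathfrak{S}_{n+1}$. For a finite group $G$, let $\mathbb{P}_{\varphi\in\mathrm{End}(G)}[\varphi\text{ is an automorphism}]=|\mathrm{Aut}(G)|/|\mathrm{End}(G)|$ be the probability that an endomorphism $\varphi$ drawn uniformly at random from the set $\mathrm{End}(G)$ of all group homomorphisms $G\to G$ is an automorphism. Then $$\lim_{n\to\infty}\mathbb{P}_{\varphi\in\mathrm{End}(C_{2n})}[\varphi\text{ is an automorphism}]=\tfrac12,\qquad \lim_{n\to\infty}\mathbb{P}_{\varphi\in\mathrm{End}(D_{n})}[\varphi\text{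 is an automorphism}]=\tfrac12,$$ $$\lim_{n\to\infty}\mathbb{P}_{\varphi\in\mathrm{End}(C_{2n+1})}[\varphi\text{ is an automorphism}]=\tfrac14,\qquad \lim_{n\to\infty}\mathbb{P}_{\varphi\in\mathrm{End}(A_{n})}[\varphi\text{ is an automorphism}]=1.$$ -/

import Mathlib

open Filter Topology

namespace ReflectionGroups

/-- The reflection group generated by the orthogonal reflections in the hyperplanes `v⟂`,
for `v` in the set of roots `Φ`. -/
noncomputable def reflectionGroup {E : Type*} [NormedAddCommGroup E] [InnerProductSpace ℝ E]
    (Φ : Set E) : Subgroup (E ≃ₗᵢ[ℝ] E) :=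
  Subgroup.closure {r | ∃ v ∈ Φ, r = (Submodule.span ℝ {v})ᗮ.reflection}

/-- The standard orthonormal basis vector `e i` of Euclidean space. -/
noncomputable def e {n : ℕ} (i : Fin n) : EuclideanSpace ℝ (Fin n) :=
  EuclideanSpace.single i (1 : ℝ)

/-- The roots of type `A n`: all `e i - e j` with `i ≠ j` in `ℝ ^ (n + 1)`. -/
def rootsA (n : ℕ) : Set (EuclideanSpace ℝ (Fin (n + 1))) :=
  {v | ∃ i j, i ≠ j ∧ v = e i - e j}

/-- The roots of type `D n`: all `e i - e j` and `e i + e j` with `i ≠ j` in `ℝ ^ n`. -/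
def rootsD (n : ℕ) : Set (EuclideanSpace ℝ (Fin n)) :=
  {v | ∃ i j, i ≠ j ∧ (v = e i - e j ∨ v = e i + e j)}

/-- The roots of type `C n`: those of type `D n` together with all `e i`.
(Only the lines spanned by the roots matter here, so `e i` may stand for `2 • e i`.) -/
def rootsC (n : ℕ) : Set (EuclideanSpace ℝ (Fin n)) :=
  rootsD n ∪ {v | ∃ i, v = e i}

/-- The reflection group of type `A n`, acting on `ℝ ^ (n + 1)` by coordinate permutations. -/
noncomputable abbrev A (n : ℕ) : Subgroup
    (EuclideanSpace ℝ (Fin (n + 1)) ≃ₗᵢ[ℝ] EuclideanSpace ℝ (Fin (n + 1))) :=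
  reflectionGroup (rootsA n)

/-- The reflection group of type `C n`, acting on `ℝ ^ n` by signed coordinate permutations. -/
noncomputable abbrev C (n : ℕ) : Subgroup
    (EuclideanSpace ℝ (Fin n) ≃ₗᵢ[ℝ] EuclideanSpace ℝ (Fin n)) :=
  reflectionGroup (rootsC n)

/-- The reflection group of type `D n`, acting on `ℝ ^ n` by signed coordinate permutations
with an even number of sign changes. -/
noncomputable abbrev D (n : ℕ) : Subgroup
    (EuclideanSpace ℝ (Fin n) ≃ₗᵢ[ℝ] EuclideanSpace ℝ (Fin n)) :=
  reflectionGroup (rootsD n)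

/-- The probability that an endomorphism of `G`, drawn uniformly at random from the (finite) set
of all endomorphisms of `G`, is an automorphism. -/
noncomputable def probAut (G : Type*) [Group G] : ℝ :=
  (Nat.card {φ : G →* G // Function.Bijective φ} : ℝ) / (Nat.card (G →* G) : ℝ)

end ReflectionGroups

/-!
Each of the groups `A n`, `C n`, `D n` is a semidirect product `N ⋊ Perm X` with `N` commutative.
For large `X` the alternating group lies in every nontrivial normal subgroup of `Perm X`, so for an
endomorphism of `N ⋊ Perm X` the composite `Perm X → N ⋊ Perm X → Perm X` either is injective,
hence an inner automorphism, or is trivial on the alternating group.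

An endomorphism of the first kind amounts to a permutation of `X` to conjugate by, a splitting of
the projection to `Perm X`, and a `Perm X`-equivariant endomorphism of `N`; it is bijective if and
only if the latter is. So the limit is the proportion of automorphisms among the equivariant
endomorphisms: for `N = {1}` it is `1`, for the even sign vectors it is `1 / 2`, and for all sign
vectors it is `1 / 2` or `1 / 4` according to the parity of `X`.

An endomorphism of the second kind factors through a quotient of bounded order `a`. The orbits of
a group of order `a` on `X` have at most `a` elements, so such a group has at most
`m ^ (m - m / a) * 2 ^ O(m)` homomorphisms to `Perm X`, where `m = #X`. This is negligible against
the number `m!` of conjugations.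
-/

namespace ReflectionGroups

open Equiv Equiv.Perm SemidirectProduct
open scoped Finset

section InnerAutomorphisms

lemma two_pow_mul_factorial_succ_lt {l : ℕ} (hl : 3 ≤ l) :
    2 ^ l * (l + 1).factorial < (2 * l).factorial := by
  induction l, hl using Nat.le_induction with
  | base => decide
  | succ l hl ih =>
    calc 2 ^ (l + 1) * (l + 1 + 1).factorial
        = 2 ^ l * (l + 1).factorial * (2 * (l + 2)) := by
          rw [pow_succ, (l + 1).factorial_succ]; ring
      _ < (2 * l).factorial * (2 * (l + 2)) := Nat.mul_lt_mul_of_pos_right ih (by omega)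
      _ ≤ (2 * l).factorial * ((2 * l + 1) * (2 * l + 2)) :=
          Nat.mul_le_mul_left _ (by nlinarith)
      _ = (2 * l + 1 + 1).factorial := by rw [Nat.factorial_succ, Nat.factorial_succ]; ring

lemma factorial_mul_two_pow_mul_factorial_succ_lt {l m : ℕ} (hl : 1 ≤ l) (h : 5 ≤ m + 2 * l) :
    m.factorial * (2 ^ l * (l + 1).factorial) < (m + 2 * l).factorial := by
  have hm := m.factorial_pos
  obtain rfl | rfl | hl : l = 1 ∨ l = 2 ∨ 3 ≤ l := by omega
  · have : 20 ≤ (m + 2) * (m + 1) := by nlinarith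
    calc m.factorial * (2 ^ 1 * (1 + 1).factorial) < 20 * m.factorial := by
          norm_num [Nat.factorial]; omega
      _ ≤ (m + 2) * (m + 1) * m.factorial := by gcongr
      _ = (m + 2 * 1).factorial := by rw [mul_assoc, ← Nat.factorial_succ, ← Nat.factorial_succ]
  · have : 5 * 4 * 3 * 2 ≤ (m + 4) * (m + 3) * (m + 2) * (m + 1) := by gcongr <;> omega
    calc m.factorial * (2 ^ 2 * (2 + 1).factorial) < 5 * 4 * 3 * 2 * m.factorial := by
          norm_num [Nat.factorial]; omega
      _ ≤ (m + 4) * (m + 3) * (m + 2) * (m + 1) * m.factorial := by gcongr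
      _ = (m + 2 * 2).factorial := by simp only [mul_assoc, ← Nat.factorial_succ]
  · calc m.factorial * (2 ^ l * (l + 1).factorial)
        < m.factorial * (2 * l).factorial := by gcongr; exact two_pow_mul_factorial_succ_lt hl
      _ ≤ (m + 2 * l).factorial := Nat.le_of_dvd (Nat.factorial_pos _)
          (Nat.factorial_mul_factorial_dvd_factorial_add _ _)

lemma card_centralizer_map {G H : Type*} [Group G] [Group H] (f : G ≃* H) (g : G) :
    Nat.card (Subgroup.centralizer {f g}) = Nat.card (Subgroup.centralizer {g}) := by
  refine (Nat.card_congr (f.toEquiv.subtypeEquiv fun a => ?_)).symm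
  simp only [Subgroup.mem_centralizer_singleton_iff, MulEquiv.toEquiv_eq_coe, EquivLike.coe_coe,
    ← map_mul, EmbeddingLike.apply_eq_iff_eq]

variable {α : Type*} [DecidableEq α]

lemma card_centralizer_of_cycleType_eq_replicate_two [Fintype α] {σ : Perm α} {l : ℕ}
    (hl : l ≠ 0) (hσ : σ.cycleType = Multiset.replicate l 2) :
    Nat.card (Subgroup.centralizer {σ}) =
      (Fintype.card α - l * 2).factorial * 2 ^ l * l.factorial := by
  simp [nat_card_centralizer, hσ, Multiset.toFinset_replicate, hl]

/-- Among involutions, transpositions have the largest centralizers. -/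
lemma isSwap_map_mulEquiv [Fintype α] (hα : 7 ≤ Fintype.card α) (f : Perm α ≃* Perm α)
    {t : Perm α} (ht : t.IsSwap) : (f t).IsSwap := by
  have h_order : orderOf (f t) = 2 := by rw [MulEquiv.orderOf_eq, ht.orderOf]
  obtain ⟨l, hl⟩ := cycleType_prime_order (h_order ▸ Nat.prime_two)
  rw [h_order] at hl
  have h_sum : (l + 1) * 2 ≤ Fintype.card α := by
    simpa only [hl, Multiset.sum_replicate, smul_eq_mul] using (f t).sum_cycleType_le
  have h_centralizer := card_centralizer_map f t
  rw [card_centralizer_of_cycleType_eq_replicate_two l.succ_ne_zero hl,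
    card_centralizer_of_cycleType_eq_replicate_two one_ne_zero (isSwap_iff_cycleType.mp ht)]
    at h_centralizer
  obtain rfl | hl_pos := l.eq_zero_or_pos
  · exact isSwap_iff_cycleType.mpr hl
  · have h_lt := factorial_mul_two_pow_mul_factorial_succ_lt
      (m := Fintype.card α - (l + 1) * 2) hl_pos (by omega)
    rw [show Fintype.card α - (l + 1) * 2 + 2 * l = Fintype.card α - 1 * 2 by omega] at h_lt
    rw [pow_succ, Nat.factorial_one] at h_centralizer
    linarith

lemma eq_or_eq_of_not_commute_swap {a b x y : α} (h : ¬ Commute (swap a b) (swap x y)) :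
    x = a ∨ x = b ∨ y = a ∨ y = b := by
  by_contra! h_ne
  refine h (Disjoint.commute fun z => ?_)
  by_cases hz : z = a ∨ z = b
  · right
    rcases hz with rfl | rfl <;> exact swap_apply_of_ne_of_ne (by tauto) (by tauto)
  · left
    exact swap_apply_of_ne_of_ne (by tauto) (by tauto)

lemma not_commute_swap_swap {o i j : α} (hi : i ≠ o) (hj : j ≠ o) (hij : i ≠ j) :
    ¬ Commute (swap o i) (swap o j) := by
  intro h
  have := DFunLike.congr_fun h.eq o
  simp only [mul_apply, swap_apply_left, swap_apply_of_ne_of_ne hj hij.symm,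
    swap_apply_of_ne_of_ne hi hij] at this
  exact hij this.symm

lemma exists_common_point_of_not_commute {s t : Perm α} (hs : s.IsSwap) (ht : t.IsSwap)
    (h : ¬ Commute s t) : ∃ c a b, a ≠ b ∧ s = swap c a ∧ t = swap c b := by
  obtain ⟨a, b, -, rfl⟩ := hs
  obtain ⟨x, y, -, rfl⟩ := ht
  have h_ne {c u v : α} (h : ¬ Commute (swap c u) (swap c v)) : u ≠ v := by
    rintro rfl
    exact h (Commute.refl _)
  rcases eq_or_eq_of_not_commute_swap h with rfl | rfl | rfl | rfl
  · exact ⟨x, b, y, h_ne h, rfl, rfl⟩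
  · rw [swap_comm a x] at h ⊢
    exact ⟨x, a, y, h_ne h, rfl, rfl⟩
  · rw [swap_comm x y] at h ⊢
    exact ⟨y, b, x, h_ne h, rfl, rfl⟩
  · rw [swap_comm x y, swap_comm a y] at h ⊢
    exact ⟨y, a, x, h_ne h, rfl, rfl⟩

lemma eq_swap_of_not_commute {t : Perm α} (ht : t.IsSwap) {a b c : α} (hab : a ≠ b)
    (ha : ¬ Commute (swap c a) t) (hb : ¬ Commute (swap c b) t) (h : t ≠ swap a b) :
    t = swap c (t c) := by
  obtain ⟨x, y, -, rfl⟩ := ht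
  have h₁ := eq_or_eq_of_not_commute_swap ha
  have h₂ := eq_or_eq_of_not_commute_swap hb
  obtain rfl | rfl : x = c ∨ y = c := by grind [swap_comm]
  · rw [swap_apply_left]
  · rw [swap_apply_right, swap_comm]

lemma swap_mul_swap_mul_swap_left {c a b : α} (hcb : c ≠ b) (hab : a ≠ b) :
    swap c a * swap c b * swap c a = swap a b := by
  rw [swap_comm c b, swap_mul_swap_mul_swap hcb.symm hab.symm]

/-- If `f` maps the star of transpositions `(o j)` to transpositions, two of the images
`(c a)`, `(c b)` determine the centre `c` of the image star; only `(a b)` could fail to pass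
through `c`, and it is already taken by `(p q)`. -/
lemma exists_center_of_isSwap_map {β : Type*} [DecidableEq β] {f : Perm α →* Perm β}
    (hf : Function.Injective f) (h_swap : ∀ t : Perm α, t.IsSwap → (f t).IsSwap) {o p q : α}
    (hpo : p ≠ o) (hqo : q ≠ o) (hpq : p ≠ q) :
    ∃ c, ∀ j, f (swap o j) = swap c (f (swap o j) c) := by
  have h_star {j} (hj : j ≠ o) : (f (swap o j)).IsSwap := h_swap _ ⟨o, j, hj.symm, rfl⟩
  have h_comm {i j} (hi : i ≠ o) (hj : j ≠ o) (hij : i ≠ j) :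
      ¬ Commute (f (swap o i)) (f (swap o j)) :=
    fun h => not_commute_swap_swap hi hj hij (h.of_map hf)
  obtain ⟨c, a, b, hab, hp, hq⟩ :=
    exists_common_point_of_not_commute (h_star hpo) (h_star hqo) (h_comm hpo hqo hpq)
  have hcb : c ≠ b := by
    rintro rfl
    obtain ⟨x, y, hxy, h⟩ := h_star hqo
    rw [hq, swap_self] at h
    exact hxy (swap_eq_refl_iff.mp h.symm)
  have h_pq : f (swap p q) = swap a b := by
    rw [← swap_mul_swap_mul_swap_left hqo.symm hpq, map_mul, map_mul, hp, hq,
      swap_mul_swap_mul_swap_left hcb hab]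
  refine ⟨c, fun j => ?_⟩
  rcases eq_or_ne j o with rfl | hjo
  · rw [swap_self, ← Perm.one_def, map_one, one_apply, swap_self, Perm.one_def]
  rcases eq_or_ne j p with rfl | hjp
  · simp [hp]
  rcases eq_or_ne j q with rfl | hjq
  · simp [hq]
  refine eq_swap_of_not_commute (h_star hjo) hab (hp ▸ h_comm hpo hjo hjp.symm)
    (hq ▸ h_comm hqo hjo hjq.symm) fun h => hjo ?_
  have := DFunLike.congr_fun (hf (h.trans h_pq.symm)) o
  rwa [swap_apply_left, swap_apply_of_ne_of_ne hpo.symm hqo.symm] at this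

lemma closure_range_swap [Finite α] (o : α) :
    Subgroup.closure (Set.range (swap o)) = ⊤ := by
  rw [eq_top_iff, ← closure_isSwap, Subgroup.closure_le]
  rintro _ ⟨i, j, hij, rfl⟩
  have h_mem (k : α) : swap o k ∈ Subgroup.closure (Set.range (swap o)) :=
    Subgroup.subset_closure ⟨k, rfl⟩
  rcases eq_or_ne o j with rfl | hj
  · exact swap_comm o i ▸ h_mem i
  · exact swap_mul_swap_mul_swap_left hj hij ▸ mul_mem (mul_mem (h_mem i) (h_mem j)) (h_mem i)

lemma exists_eq_conj_of_map_swap [Finite α] {f : Perm α →* Perm α} (hf : Function.Injective f)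
    {o c : α} (hc : ∀ j, f (swap o j) = swap c (f (swap o j) c)) :
    ∃ σ : Perm α, f = (MulAut.conj σ).toMonoidHom := by
  have h_inj : Function.Injective fun j => f (swap o j) c := fun i j hij => by
    have : swap o i = swap o j := hf (by rw [hc i, hc j]; exact congrArg _ hij)
    simpa using DFunLike.congr_fun this o
  let σ : Perm α := .ofBijective _ (Finite.injective_iff_bijective.mp h_inj)
  have hσ (j : α) : σ j = f (swap o j) c := rfl
  have hσo : σ o = c := by rw [hσ, swap_self, ← Perm.one_def, map_one, one_apply]
  refine ⟨σ, MonoidHom.eq_of_eqOn_dense (closure_range_swap o) ?_⟩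
  rintro _ ⟨j, rfl⟩
  change f (swap o j) = σ * swap o j * σ⁻¹
  rw [hc, ← hσ, ← hσo, ← swap_apply_apply]

end InnerAutomorphisms

theorem conj_surjective_of_seven_le_card {α : Type*} [Fintype α] (hα : 7 ≤ Fintype.card α) :
    Function.Surjective (MulAut.conj : Perm α →* MulAut (Perm α)) := by
  classical
  intro f
  obtain ⟨o, p, q, hop, hoq, hpq⟩ := Fintype.two_lt_card_iff.mp (by omega : 2 < Fintype.card α)
  obtain ⟨c, hc⟩ := exists_center_of_isSwap_map (f := f.toMonoidHom) f.injective
    (fun _ => isSwap_map_mulEquiv hα f) hop.symm hoq.symm hpq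
  obtain ⟨σ, hσ⟩ := exists_eq_conj_of_map_swap f.injective hc
  exact ⟨σ, MulEquiv.ext fun τ => (DFunLike.congr_fun hσ τ).symm⟩

section PermutationRepresentations

lemma card_filter_fixes_le {X : Type*} [Fintype X] [DecidableEq X] (R : Finset X) :
    #{f : X → X | ∀ x ∈ R, f x = x} ≤ Fintype.card X ^ (Fintype.card X - #R) := by
  calc #{f : X → X | ∀ x ∈ R, f x = x} ≤ Fintype.card ({x // x ∉ R} → X) := by
        refine Finset.card_le_card_of_injOn (fun f x => f x) (by simp) fun f hf g hg hfg => ?_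
        simp only [Finset.coe_filter, Finset.mem_univ, true_and, Set.mem_ofPred_eq] at hf hg
        funext x
        by_cases hx : x ∈ R
        · rw [hf x hx, hg x hx]
        · exact congrFun hfg ⟨x, hx⟩
    _ = Fintype.card X ^ (Fintype.card X - #R) := by
        rw [Fintype.card_fun, Fintype.card_subtype_compl, Fintype.card_coe]

lemma card_filter_le_card_fixed_le (X : Type*) [Fintype X] [DecidableEq X] (k : ℕ) :
    #{f : X → X | k ≤ #{x | f x = x}} ≤
      Fintype.card X ^ (Fintype.card X - k) * 2 ^ Fintype.card X := by
  rcases isEmpty_or_nonempty X with hX | hX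
  · simpa using Finset.card_le_univ {f : X → X | k ≤ #{x | f x = x}}
  refine (Finset.card_le_mul_card_image (f := fun f : X → X => ({x | f x = x} : Finset X)) _
    (Fintype.card X ^ (Fintype.card X - k)) fun R hR => ?_).trans ?_
  · obtain ⟨f, hf, rfl⟩ := Finset.mem_image.mp hR
    refine (Finset.card_le_card fun g hg => ?_).trans ((card_filter_fixes_le {x | f x = x}).trans
      (Nat.pow_le_pow_right Fintype.card_pos (Nat.sub_le_sub_left (Finset.mem_filter.mp hf).2 _)))
    simp only [← (Finset.mem_filter.mp hg).2, Finset.mem_filter, Finset.mem_univ, true_and,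
      imp_self, implies_true]
  · exact Nat.mul_le_mul_left _ ((Finset.card_le_univ _).trans_eq (Fintype.card_finset))

variable {Q X : Type*} [Group Q]

/-- A chosen representative of the orbit of a point under a permutation representation. -/
noncomputable def orbitRep (ρ : Q →* Perm X) (x : X) : X :=
  (Quotient.mk (MulAction.orbitRel ρ.range X) x).out

/-- The elements that carry the chosen representative of the orbit of a point to that point.
Together with `orbitRep ρ`, these sets determine `ρ`. -/
def transporter (ρ : Q →* Perm X) (x : X) : Set Q :=
  {g | ρ g (orbitRep ρ x) = x}

lemma exists_apply_orbitRep_eq (ρ : Q →* Perm X) (x : X) : ∃ g, ρ g (orbitRep ρ x) = x := by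
  obtain ⟨⟨_, g, rfl⟩, hg⟩ := MulAction.orbitRel_apply.mp
    ((MulAction.orbitRel ρ.range X).symm (Quotient.mk_out x))
  exact ⟨g, hg⟩

lemma orbitRep_apply (ρ : Q →* Perm X) (g : Q) (x : X) :
    orbitRep ρ (ρ g x) = orbitRep ρ x :=
  congrArg Quotient.out (Quotient.sound (MulAction.orbitRel_apply.mpr ⟨⟨ρ g, g, rfl⟩, rfl⟩))

lemma orbitRep_orbitRep (ρ : Q →* Perm X) (x : X) :
    orbitRep ρ (orbitRep ρ x) = orbitRep ρ x := by
  obtain ⟨g, hg⟩ := exists_apply_orbitRep_eq ρ x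
  conv_rhs => rw [← hg, orbitRep_apply]

lemma eq_of_orbitRep_eq_of_transporter_eq {ρ₁ ρ₂ : Q →* Perm X}
    (h_rep : orbitRep ρ₁ = orbitRep ρ₂) (h_trans : transporter ρ₁ = transporter ρ₂) :
    ρ₁ = ρ₂ := by
  ext g x
  obtain ⟨h, hx₁⟩ := exists_apply_orbitRep_eq ρ₁ x
  have hx₂ : ρ₂ h (orbitRep ρ₂ x) = x := by
    have : h ∈ transporter ρ₁ x := hx₁
    rwa [h_trans] at this
  have hgh : g * h ∈ transporter ρ₁ (ρ₁ g x) := by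
    simp only [transporter, Set.mem_ofPred_eq, orbitRep_apply, map_mul, mul_apply, hx₁]
  have h_rep₂ : orbitRep ρ₂ (ρ₁ g x) = orbitRep ρ₂ x := by rw [← h_rep, orbitRep_apply]
  rw [h_trans] at hgh
  simp only [transporter, Set.mem_ofPred_eq, h_rep₂, map_mul, mul_apply, hx₂] at hgh
  exact hgh.symm

variable [Fintype X] [DecidableEq X] [Finite Q]

lemma card_le_card_mul_card_fixed_orbitRep (ρ : Q →* Perm X) :
    Fintype.card X ≤ Nat.card Q * #{x | orbitRep ρ x = x} := by
  have := Fintype.ofFinite Q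
  refine Finset.card_le_mul_card_image_of_maps_to (f := orbitRep ρ)
    (fun x _ => by simp [orbitRep_orbitRep]) (Nat.card Q) fun r _ => ?_
  calc #{x | orbitRep ρ x = r} ≤ #(Finset.univ.image fun g => ρ g r) := by
        refine Finset.card_le_card fun x hx => ?_
        obtain ⟨g, hg⟩ := exists_apply_orbitRep_eq ρ x
        rw [(Finset.mem_filter.mp hx).2] at hg
        exact Finset.mem_image.mpr ⟨g, Finset.mem_univ _, hg⟩
    _ ≤ Nat.card Q := Finset.card_image_le.trans_eq (by simp)

/-- A representation is encoded by its map of orbit representatives, which has at least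
`|X| / |Q|` fixed points, and its transporters. -/
theorem card_hom_perm_le (Q X : Type*) [Group Q] [Finite Q] [Fintype X] :
    Nat.card (Q →* Perm X) ≤ Fintype.card X ^ (Fintype.card X - Fintype.card X / Nat.card Q) *
      2 ^ ((Nat.card Q + 1) * Fintype.card X) := by
  classical
  have := Fintype.ofFinite Q
  let S : Finset (X → X) := {f | Fintype.card X / Nat.card Q ≤ #{x | f x = x}}
  let code (ρ : Q →* Perm X) : S × (X → Set Q) :=
    (⟨orbitRep ρ, Finset.mem_filter.mpr ⟨Finset.mem_univ _,
      Nat.div_le_of_le_mul (card_le_card_mul_card_fixed_orbitRep ρ)⟩⟩, transporter ρ)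
  have h_code : Function.Injective code := fun ρ₁ ρ₂ h => by
    simp only [code, Prod.mk.injEq, Subtype.mk.injEq] at h
    exact eq_of_orbitRep_eq_of_transporter_eq h.1 h.2
  calc Nat.card (Q →* Perm X) ≤ Nat.card (S × (X → Set Q)) := Nat.card_le_card_of_injective _ h_code
    _ = #S * (2 ^ Nat.card Q) ^ Fintype.card X := by simp
    _ ≤ Fintype.card X ^ (Fintype.card X - Fintype.card X / Nat.card Q) * 2 ^ Fintype.card X *
          (2 ^ Nat.card Q) ^ Fintype.card X := by
        gcongr
        exact card_filter_le_card_fixed_le X _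
    _ = _ := by rw [mul_assoc, ← pow_mul, ← pow_add, add_one_mul, add_comm]

end PermutationRepresentations

section PerfectMonolith

variable {P H : Type*} [Group P] [Group H] {K : Subgroup P}

/-- `K` is a nontrivial perfect subgroup contained in every nontrivial normal subgroup of `P`, as
the alternating group is in the symmetric group on at least five letters. -/
structure IsPerfectMonolith (K : Subgroup P) : Prop where
  ne_bot : K ≠ ⊥
  commutator_self : ⁅K, K⁆ = K
  le_of_normal : ∀ L : Subgroup P, L.Normal → L ≠ ⊥ → K ≤ L

lemma isPerfectMonolith_alternatingGroup {α : Type*} [Fintype α] [DecidableEq α]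
    (hα : 5 ≤ Nat.card α) : IsPerfectMonolith (alternatingGroup α) where
  ne_bot := by
    have := alternatingGroup.nontrivial_of_three_le_card (α := α) (by omega)
    exact (Subgroup.nontrivial_iff_ne_bot _).mp this
  commutator_self := commutator_alternatingGroup_eq_self hα
  le_of_normal L _ hL := alternatingGroup_le_of_normal hα
    ((Subgroup.nontrivial_iff_ne_bot L).mpr hL)

namespace IsPerfectMonolith

lemma le_ker_of_commute_map (hK : IsPerfectMonolith K) (f : P →* H)
    (hf : ∀ σ ∈ K, ∀ τ ∈ K, Commute (f σ) (f τ)) : K ≤ f.ker := by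
  rw [← hK.commutator_self, Subgroup.commutator_le]
  intro σ hσ τ hτ
  rw [MonoidHom.mem_ker, map_commutatorElement, commutatorElement_eq_one_iff_commute]
  exact hf σ hσ τ hτ

lemma eq_bot_of_commute (hK : IsPerfectMonolith K) {L : Subgroup P} (hL : L.Normal)
    (h_comm : ∀ σ ∈ L, ∀ τ ∈ L, Commute σ τ) : L = ⊥ := by
  by_contra h_ne
  have hKL := hK.le_of_normal L hL h_ne
  have hK_ker := hK.le_ker_of_commute_map (MonoidHom.id P)
    fun σ hσ τ hτ => h_comm σ (hKL hσ) τ (hKL hτ)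
  rw [(MonoidHom.ker_eq_bot_iff _).mpr Function.injective_id, le_bot_iff] at hK_ker
  exact hK.ne_bot hK_ker

lemma center_eq_bot (hK : IsPerfectMonolith K) : Subgroup.center P = ⊥ :=
  hK.eq_bot_of_commute inferInstance fun _ hσ τ _ => (Subgroup.mem_center_iff.mp hσ τ).symm

lemma injective_or_le_ker (hK : IsPerfectMonolith K) (f : P →* H) :
    Function.Injective f ∨ K ≤ f.ker := by
  rw [← MonoidHom.ker_eq_bot_iff]
  exact or_iff_not_imp_left.mpr (hK.le_of_normal _ inferInstance)

lemma not_le_ker_of_injective (hK : IsPerfectMonolith K) {f : P →* H}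
    (hf : Function.Injective f) : ¬ K ≤ f.ker := by
  rw [(MonoidHom.ker_eq_bot_iff f).mpr hf, le_bot_iff]
  exact hK.ne_bot

end IsPerfectMonolith

end PerfectMonolith

section SemidirectProductEndomorphisms

variable {N P : Type*} [CommGroup N] [Group P] {act : P →* MulAut N}

/-- The endomorphisms of the kernel of `N ⋊[act] P` that commute with the action. -/
abbrev EquivariantEnd (act : P →* MulAut N) : Type _ :=
  {θ : N →* N // ∀ σ v, θ (act σ v) = act σ (θ v)}

/-- The proportion of bijections among the equivariant endomorphisms, to be compared with
`probAut (N ⋊[act] P)`. -/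
noncomputable def equivariantProbAut (act : P →* MulAut N) : ℝ :=
  (Nat.card {θ : EquivariantEnd act // Function.Bijective θ.1} : ℝ) / Nat.card (EquivariantEnd act)

lemma mul_inl_mul_inv (g : N ⋊[act] P) (v : N) : g * inl v * g⁻¹ = inl (act g.right v) := by
  ext <;> simp [mul_comm]

lemma eq_inl_of_right_eq_one {g : N ⋊[act] P} (hg : g.right = 1) : g = inl g.left := by
  ext <;> simp [hg]

/-- The endomorphism over `P` given by an equivariant endomorphism and a splitting. -/
def endOfSplitting (θ : EquivariantEnd act) (s : (toGroupExtension act).Splitting) :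
    N ⋊[act] P →* N ⋊[act] P :=
  lift (inl.comp θ.1) s.toMonoidHom fun τ => by
    ext1 v
    have : (s.toMonoidHom τ).right = τ := right_splitting s τ
    simp only [MonoidHom.comp_apply, MulEquiv.coe_toMonoidHom, MulAut.conj_apply,
      mul_inl_mul_inv, this, θ.2]

variable (θ : EquivariantEnd act) (s : (toGroupExtension act).Splitting)

lemma endOfSplitting_inl (v : N) : endOfSplitting θ s (inl v) = inl (θ.1 v) :=
  lift_inl _ _ _ _

lemma endOfSplitting_inr (τ : P) : endOfSplitting θ s (inr τ) = s τ :=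
  lift_inr _ _ _ _

lemma right_endOfSplitting (g : N ⋊[act] P) : (endOfSplitting θ s g).right = g.right := by
  rw [← inl_left_mul_inr_right g, map_mul, endOfSplitting_inl, endOfSplitting_inr]
  simp [right_splitting]

lemma endOfSplitting_injective_iff :
    Function.Injective (endOfSplitting θ s) ↔ Function.Injective θ.1 := by
  refine ⟨fun h v w hvw => inl_injective (h ?_), fun h => ?_⟩
  · rw [endOfSplitting_inl, endOfSplitting_inl, hvw]
  · rw [injective_iff_map_eq_one]
    intro g hg
    have h_right : g.right = 1 := by rw [← right_endOfSplitting θ s, hg, one_right]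
    rw [eq_inl_of_right_eq_one h_right, endOfSplitting_inl, ← map_one inl, inl_inj] at hg
    rw [eq_inl_of_right_eq_one h_right, (injective_iff_map_eq_one _).mp h _ hg, map_one]

variable {θ s}

/-- The endomorphism `endOfSplitting θ s` followed by the conjugation by an element of `P`. -/
def endOfTriple (x : P × EquivariantEnd act × (toGroupExtension act).Splitting) :
    N ⋊[act] P →* N ⋊[act] P :=
  (MulAut.conj (inr x.1)).toMonoidHom.comp (endOfSplitting x.2.1 x.2.2)

lemma right_endOfTriple_inr (x : P × EquivariantEnd act × (toGroupExtension act).Splitting)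
    (τ : P) : (endOfTriple x (inr τ)).right = x.1 * τ * x.1⁻¹ := by
  simp [endOfTriple, right_endOfSplitting]

lemma endOfTriple_injective (hP : Subgroup.center P = ⊥) :
    Function.Injective (endOfTriple (act := act)) := by
  rintro ⟨σ, θ, s⟩ ⟨σ', θ', s'⟩ h
  obtain rfl : σ = σ' := by
    have h_center : σ'⁻¹ * σ ∈ Subgroup.center P := by
      rw [Subgroup.mem_center_iff]
      intro τ
      have := congrArg right (DFunLike.congr_fun h (inr τ))
      rw [right_endOfTriple_inr, right_endOfTriple_inr, mul_inv_eq_iff_eq_mul] at this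
      rw [mul_assoc, this]
      group
    rw [hP, Subgroup.mem_bot, inv_mul_eq_one] at h_center
    exact h_center.symm
  have h_end (g) : endOfSplitting θ s g = endOfSplitting θ' s' g :=
    (MulAut.conj (inr σ : N ⋊[act] P)).injective (DFunLike.congr_fun h g)
  have hθ : θ = θ' := Subtype.ext <| MonoidHom.ext fun v => inl_injective (by
    rw [← endOfSplitting_inl θ s, h_end, endOfSplitting_inl])
  have hs : s = s' := DFunLike.ext _ _ fun τ => by
    rw [← endOfSplitting_inr θ s, h_end, endOfSplitting_inr]
  rw [hθ, hs]

lemma exists_eq_endOfSplitting (φ : N ⋊[act] P →* N ⋊[act] P)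
    (hr : ∀ τ, (φ (inr τ)).right = τ) (hl : ∀ v, (φ (inl v)).right = 1) :
    ∃ θ s, φ = endOfSplitting (act := act) θ s := by
  have h_inl (v : N) : φ (inl v) = inl (φ (inl v)).left := eq_inl_of_right_eq_one (hl v)
  refine ⟨⟨⟨⟨fun v => (φ (inl v)).left, by simp⟩, fun v w => by simp [hl]⟩, fun σ v => ?_⟩,
    ⟨φ.comp inr, hr⟩, hom_ext (MonoidHom.ext fun v => ?_) (MonoidHom.ext fun τ => ?_)⟩
  · refine inl_injective (φ := act) ?_
    change inl (φ (inl (act σ v))).left = inl (act σ (φ (inl v)).left)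
    rw [← h_inl, inl_aut, map_mul, map_mul, h_inl v, map_inv, map_inv, mul_inl_mul_inv, hr]
    rfl
  · rw [MonoidHom.comp_apply, MonoidHom.comp_apply, endOfSplitting_inl]
    exact h_inl v
  · rw [MonoidHom.comp_apply, MonoidHom.comp_apply, endOfSplitting_inr]
    rfl

variable {K : Subgroup P} (hK : IsPerfectMonolith K)

include hK

lemma right_map_inl_eq_one (φ : N ⋊[act] P →* N ⋊[act] P) (hr : ∀ τ, (φ (inr τ)).right = τ)
    (v : N) : (φ (inl v)).right = 1 := by
  let f : N →* P := (rightHom.comp φ).comp inl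
  have h_normal : f.range.Normal := ⟨by
    rintro _ ⟨v, rfl⟩ τ
    refine ⟨act τ v, ?_⟩
    simp only [f, MonoidHom.comp_apply, inl_aut, map_mul, rightHom_eq_right, hr]⟩
  have h_range : f.range = ⊥ := hK.eq_bot_of_commute h_normal <| by
    rintro _ ⟨v, rfl⟩ _ ⟨w, rfl⟩
    exact (Commute.all v w).map f
  rw [← Subgroup.mem_bot, ← h_range]
  exact ⟨v, rfl⟩

lemma exists_eq_endOfTriple [Finite P]
    (hP : Function.Surjective (MulAut.conj : P →* MulAut P)) (φ : N ⋊[act] P →* N ⋊[act] P)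
    (hφ : Function.Injective fun τ => (φ (inr τ)).right) : ∃ x, endOfTriple (act := act) x = φ := by
  obtain ⟨σ, hσ⟩ := hP <| MulEquiv.ofBijective ((rightHom.comp φ).comp inr)
    (Finite.injective_iff_bijective.mp hφ)
  let ψ : N ⋊[act] P →* N ⋊[act] P := (MulAut.conj (inr σ⁻¹)).toMonoidHom.comp φ
  have hr (τ : P) : (ψ (inr τ)).right = τ := by
    have : (φ (inr τ)).right = σ * τ * σ⁻¹ := (DFunLike.congr_fun hσ τ).symm
    simp [ψ, this, mul_assoc]
  obtain ⟨θ, s, h⟩ := exists_eq_endOfSplitting ψ hr (right_map_inl_eq_one hK ψ hr)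
  refine ⟨(σ, θ, s), MonoidHom.ext fun g => ?_⟩
  change MulAut.conj (inr σ) (endOfSplitting θ s g) = φ g
  rw [← h]
  simp [ψ, mul_assoc]

lemma injective_right_map_inr_or_le_ker (φ : N ⋊[act] P →* N ⋊[act] P) :
    (Function.Injective fun τ => (φ (inr τ)).right) ∨ K ≤ (φ.comp inr).ker := by
  refine (hK.injective_or_le_ker ((rightHom.comp φ).comp inr)).imp_right fun h => ?_
  refine hK.le_ker_of_commute_map _ fun σ hσ τ hτ => ?_
  rw [MonoidHom.comp_apply, MonoidHom.comp_apply, eq_inl_of_right_eq_one (h hσ),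
    eq_inl_of_right_eq_one (h hτ)]
  exact (Commute.all _ _).map inl

end SemidirectProductEndomorphisms

section Count

instance finite_monoidHom {M N : Type*} [MulOneClass M] [MulOneClass N] [Finite M] [Finite N] :
    Finite (M →* N) := DFunLike.finite _

lemma abs_mul_div_add_sub_div_le {p u e b : ℝ} (hp : 0 < p) (hu : 0 ≤ u) (hue : u ≤ e)
    (he : 0 < e) (hb : 0 ≤ b) : |p * u / (p * e + b) - u / e| ≤ b / (p * e) := by
  have : 0 < p * e + b := by positivity
  have h_sub : p * u / (p * e + b) - u / e = -(u / e * (b / (p * e + b))) := by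
    field_simp
    ring
  rw [h_sub, abs_neg, abs_of_nonneg (by positivity)]
  calc u / e * (b / (p * e + b)) ≤ 1 * (b / (p * e)) := by
        gcongr
        · exact (div_le_one he).mpr hue
        · exact le_add_of_nonneg_right hb
    _ = b / (p * e) := one_mul _

instance finite_semidirectProduct {N P : Type*} [Group N] [Group P] [Finite N] [Finite P]
    {act : P →* MulAut N} : Finite (N ⋊[act] P) := Finite.of_equiv _ equivProd.symm

variable {N P : Type*} [CommGroup N] [Group P] [Finite N] [Finite P] {act : P →* MulAut N}

instance finite_splitting : Finite (toGroupExtension act).Splitting := DFunLike.finite _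

lemma endOfTriple_bijective_iff (x : P × EquivariantEnd act × (toGroupExtension act).Splitting) :
    Function.Bijective (endOfTriple x) ↔ Function.Bijective x.2.1.1 := by
  rw [← Finite.injective_iff_bijective, ← Finite.injective_iff_bijective,
    ← endOfSplitting_injective_iff x.2.1 x.2.2]
  exact (MulAut.conj (inr x.1 : N ⋊[act] P)).injective.of_comp_iff (endOfSplitting x.2.1 x.2.2)

variable {K : Subgroup P} (hK : IsPerfectMonolith K)
  (hP : Function.Surjective (MulAut.conj : P →* MulAut P))

include hK hP

lemma card_bijective_end :
    Nat.card {φ : N ⋊[act] P →* N ⋊[act] P // Function.Bijective φ} =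
      Nat.card P * Nat.card (toGroupExtension act).Splitting *
        Nat.card {θ : EquivariantEnd act // Function.Bijective θ.1} := by
  let f (x : P × (toGroupExtension act).Splitting ×
        {θ : EquivariantEnd act // Function.Bijective θ.1}) :
      {φ : N ⋊[act] P →* N ⋊[act] P // Function.Bijective φ} :=
    ⟨endOfTriple (x.1, x.2.2.1, x.2.1), (endOfTriple_bijective_iff _).mpr x.2.2.2⟩
  have hf : Function.Bijective f := by
    constructor
    · rintro ⟨σ, s, ⟨θ, hθ⟩⟩ ⟨σ', s', ⟨θ', hθ'⟩⟩ h
      have := endOfTriple_injective hK.center_eq_bot (congrArg Subtype.val h)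
      simp only [Prod.mk.injEq] at this
      obtain ⟨rfl, rfl, rfl⟩ := this
      rfl
    · rintro ⟨φ, hφ⟩
      obtain ⟨x, rfl⟩ := exists_eq_endOfTriple hK hP φ <|
        (injective_right_map_inr_or_le_ker hK φ).resolve_right
          (hK.not_le_ker_of_injective (hφ.1.comp inr_injective))
      exact ⟨(x.1, x.2.2, ⟨x.2.1, (endOfTriple_bijective_iff _).mp hφ⟩), rfl⟩
  rw [← Nat.card_congr (.ofBijective f hf), Nat.card_prod, Nat.card_prod, mul_assoc]

lemma card_end :
    Nat.card (N ⋊[act] P →* N ⋊[act] P) =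
      Nat.card P * Nat.card (toGroupExtension act).Splitting * Nat.card (EquivariantEnd act) +
        Nat.card {φ : N ⋊[act] P →* N ⋊[act] P // K ≤ (φ.comp inr).ker} := by
  let f : (P × EquivariantEnd act × (toGroupExtension act).Splitting) ⊕
      {φ : N ⋊[act] P →* N ⋊[act] P // K ≤ (φ.comp inr).ker} → (N ⋊[act] P →* N ⋊[act] P) :=
    Sum.elim endOfTriple Subtype.val
  have hf : Function.Bijective f := by
    constructor
    · refine (endOfTriple_injective hK.center_eq_bot).sumElim Subtype.val_injective ?_
      rintro x ⟨φ, hφ⟩ rfl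
      refine hK.not_le_ker_of_injective (fun τ τ' h => ?_) hφ
      have := congrArg right h
      rw [MonoidHom.comp_apply, MonoidHom.comp_apply, right_endOfTriple_inr,
        right_endOfTriple_inr] at this
      simpa using this
    · intro φ
      rcases injective_right_map_inr_or_le_ker hK φ with h | h
      · obtain ⟨x, hx⟩ := exists_eq_endOfTriple hK hP φ h
        exact ⟨.inl x, hx⟩
      · exact ⟨.inr ⟨φ, h⟩, rfl⟩
  rw [← Nat.card_congr (.ofBijective f hf), Nat.card_sum, Nat.card_prod, Nat.card_prod,
    mul_comm (Nat.card (EquivariantEnd act)), mul_assoc]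

theorem abs_probAut_sub_equivariantProbAut_le :
    |probAut (N ⋊[act] P) - equivariantProbAut act| ≤
      Nat.card {φ : N ⋊[act] P →* N ⋊[act] P // K ≤ (φ.comp inr).ker} / Nat.card P := by
  have : Nonempty (EquivariantEnd act) := ⟨⟨MonoidHom.id N, fun _ _ => rfl⟩⟩
  have : Nonempty (toGroupExtension act).Splitting := ⟨inr_splitting act⟩
  have he : 1 ≤ Nat.card (EquivariantEnd act) := Nat.card_pos
  have hs : 1 ≤ Nat.card (toGroupExtension act).Splitting := Nat.card_pos
  have hp : 0 < Nat.card P := Nat.card_pos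
  have hue : Nat.card {θ : EquivariantEnd act // Function.Bijective θ.1} ≤
      Nat.card (EquivariantEnd act) := Nat.card_le_card_of_injective _ Subtype.val_injective
  have h_le : Nat.card P ≤
      Nat.card P * Nat.card (toGroupExtension act).Splitting * Nat.card (EquivariantEnd act) := by
    rw [mul_assoc]
    exact Nat.le_mul_of_pos_right _ (Nat.mul_pos hs he)
  rw [probAut, equivariantProbAut, card_bijective_end hK hP, card_end hK hP]
  push_cast
  refine (abs_mul_div_add_sub_div_le (by positivity) (by positivity) (mod_cast hue)
    (by positivity) (by positivity)).trans ?_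
  gcongr
  exact_mod_cast h_le

end Count

section Quotient

variable {N P H : Type*} [Group N] [Group P] [Group H]

/-- The largest quotient of `N ⋊[act] P` in which the subgroup `K` of `P` becomes trivial. -/
abbrev NormalClosureQuotient (act : P →* MulAut N) (K : Subgroup P) : Type _ :=
  (N ⋊[act] P) ⧸ Subgroup.normalClosure (inr '' K : Set (N ⋊[act] P))

variable {act : P →* MulAut N}

lemma inl_div_act_mem_normalClosure {K : Subgroup P} {σ : P} (hσ : σ ∈ K) (v : N) :
    inl (v / act σ v) ∈ Subgroup.normalClosure (inr '' K : Set (N ⋊[act] P)) := by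
  have h_mem : inr σ ∈ Subgroup.normalClosure (inr '' K : Set (N ⋊[act] P)) :=
    Subgroup.subset_normalClosure ⟨σ, hσ, rfl⟩
  have h_comm : (inl (v / act σ v) : N ⋊[act] P) = inl v * inr σ * (inl v)⁻¹ * (inr σ)⁻¹ := by
    rw [div_eq_mul_inv, map_mul, ← map_inv (act σ), inl_aut]
    simp only [map_inv, mul_assoc]
  rw [h_comm]
  exact mul_mem (Subgroup.normalClosure_normal.conj_mem _ h_mem _) (inv_mem h_mem)

lemma card_normalClosureQuotient_le {Q R : Type*} [Group Q] [Group R] [Finite Q] [Finite R]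
    {K : Subgroup P} (π : N →* Q) (hπ : ∀ σ v, π (act σ v) = π v)
    (hπ_ker : ∀ v ∈ π.ker, inl v ∈ Subgroup.normalClosure (inr '' K : Set (N ⋊[act] P)))
    (χ : P →* R) (hχ : χ.ker ≤ K) :
    Nat.card (NormalClosureQuotient act K) ≤ Nat.card Q * Nat.card R := by
  let f : N ⋊[act] P →* Q × R :=
    lift ((MonoidHom.inl Q R).comp π) ((MonoidHom.inr Q R).comp χ) fun σ => by
      ext v <;> simp [hπ]
  have hf : f.ker ≤ Subgroup.normalClosure (inr '' K) := by
    intro g hg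
    have h_split : f g = (π g.left, χ g.right) := by simp [f, lift]
    rw [MonoidHom.mem_ker, h_split, Prod.mk_eq_one] at hg
    rw [← inl_left_mul_inr_right g]
    exact mul_mem (hπ_ker _ hg.1) (Subgroup.subset_normalClosure ⟨_, hχ hg.2, rfl⟩)
  calc Nat.card (NormalClosureQuotient act K) ≤ f.ker.index :=
        Nat.le_of_dvd (Nat.pos_of_ne_zero Subgroup.index_ne_zero_of_finite)
          (Subgroup.index_dvd_of_le hf)
    _ ≤ Nat.card (Q × R) := by
        rw [Subgroup.index_ker]
        exact Nat.card_le_card_of_injective _ Subtype.val_injective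
    _ = Nat.card Q * Nat.card R := Nat.card_prod Q R

variable [Finite N] [Finite P]

lemma card_hom_trivial_on_le [Finite H] (K : Subgroup P) :
    Nat.card {φ : N ⋊[act] P →* H // K ≤ (φ.comp inr).ker} ≤
      Nat.card (NormalClosureQuotient act K →* H) := by
  have h_ker (φ : {φ : N ⋊[act] P →* H // K ≤ (φ.comp inr).ker}) :
      Subgroup.normalClosure (inr '' K) ≤ φ.1.ker :=
    Subgroup.normalClosure_le_normal (Set.image_subset_iff.mpr φ.2)
  refine Nat.card_le_card_of_injective (fun φ => QuotientGroup.lift _ φ.1 (h_ker φ))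
    fun φ ψ h => Subtype.ext (MonoidHom.ext fun g => ?_)
  exact DFunLike.congr_fun h (QuotientGroup.mk g)

lemma card_hom_semidirectProduct_le (Q : Type*) [Group Q] [Finite Q] :
    Nat.card (Q →* N ⋊[act] P) ≤ Nat.card N ^ Nat.card Q * Nat.card (Q →* P) := by
  let f (φ : Q →* N ⋊[act] P) : (Q → N) × (Q →* P) := (fun q => (φ q).left, rightHom.comp φ)
  have hf : Function.Injective f := fun φ ψ h => by
    simp only [f, Prod.mk.injEq] at h
    ext q
    exacts [congrFun h.1 q, DFunLike.congr_fun h.2 q]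
  exact (Nat.card_le_card_of_injective f hf).trans_eq (by rw [Nat.card_prod, Nat.card_fun])

lemma card_hom_semidirectProduct_perm_le {X Q : Type*} [Fintype X] [Group Q] [Finite Q]
    {act : Perm X →* MulAut N} {a c : ℕ} (hQ : Nat.card Q ≤ a)
    (hN : Nat.card N ≤ c ^ Fintype.card X) :
    Nat.card (Q →* N ⋊[act] Perm X) ≤ (c ^ Fintype.card X) ^ a *
      (Fintype.card X ^ (Fintype.card X - Fintype.card X / a) *
        2 ^ ((a + 1) * Fintype.card X)) := by
  have hN_pos : 0 < Nat.card N := Nat.card_pos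
  have hQ_pos : 0 < Nat.card Q := Nat.card_pos
  have h_perm : Nat.card (Q →* Perm X) ≤ Fintype.card X ^ (Fintype.card X - Fintype.card X / a) *
      2 ^ ((a + 1) * Fintype.card X) := by
    refine (card_hom_perm_le Q X).trans ?_
    rcases (Fintype.card X).eq_zero_or_pos with hX | hX
    · simp [hX]
    · gcongr
      exact one_le_two
  calc Nat.card (Q →* N ⋊[act] Perm X) ≤ Nat.card N ^ Nat.card Q * Nat.card (Q →* Perm X) :=
        card_hom_semidirectProduct_le Q
    _ ≤ (c ^ Fintype.card X) ^ a * _ := by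
        gcongr
        exact hN_pos.trans_le hN

end Quotient

section Limit

lemma pow_self_le_factorial_mul_exp_pow (m : ℕ) :
    (m : ℝ) ^ m ≤ m.factorial * Real.exp 1 ^ m := by
  have := Real.pow_div_factorial_le_exp (x := m) m.cast_nonneg m
  rwa [div_le_iff₀' (by positivity), ← mul_one (m : ℝ), Real.exp_nat_mul, mul_one] at this

lemma tendsto_pow_div_pow_div {L : ℝ} (hL : 1 ≤ L) {a : ℕ} (ha : 0 < a) :
    Tendsto (fun m : ℕ => L ^ m / (m : ℝ) ^ (m / a)) atTop (𝓝 0) := by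
  refine squeeze_zero' (.of_forall fun m => by positivity) ?_
    (tendsto_pow_atTop_nhds_zero_of_lt_one (r := (1 / 2 : ℝ)) (by norm_num) (by norm_num))
  filter_upwards [eventually_ge_atTop ⌈(2 * L) ^ (2 * a)⌉₊, eventually_ge_atTop a] with m hLm ham
  have h_exponent : m ≤ 2 * a * (m / a) := by
    have h₁ : m < a * (m / a + 1) := Nat.lt_mul_div_succ m ha
    have h₂ : 1 ≤ m / a := Nat.div_pos ham ha
    nlinarith
  have h_pow : (2 * L) ^ m ≤ (m : ℝ) ^ (m / a) :=
    calc (2 * L) ^ m ≤ (2 * L) ^ (2 * a * (m / a)) :=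
          pow_le_pow_right₀ (by linarith) h_exponent
      _ = ((2 * L) ^ (2 * a)) ^ (m / a) := pow_mul _ _ _
      _ ≤ (m : ℝ) ^ (m / a) := by
          gcongr
          exact Nat.ceil_le.mp hLm
  calc L ^ m / (m : ℝ) ^ (m / a) ≤ L ^ m / (2 * L) ^ m := by gcongr
    _ = (1 / 2) ^ m := by
        rw [← div_pow]
        congr 1
        field_simp

lemma card_bound_div_factorial_le {m a c : ℕ} (hm : 0 < m) :
    (((c ^ m) ^ a * (m ^ (m - m / a) * 2 ^ ((a + 1) * m)) : ℕ) : ℝ) / m.factorial ≤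
      (c ^ a * 2 ^ (a + 1) * Real.exp 1) ^ m / (m : ℝ) ^ (m / a) := by
  have : (0 : ℝ) < m := mod_cast hm
  have h_split : (m : ℝ) ^ (m - m / a) * (m : ℝ) ^ (m / a) = (m : ℝ) ^ m := by
    rw [← pow_add, Nat.sub_add_cancel (Nat.div_le_self m a)]
  rw [div_le_div_iff₀ (by positivity) (by positivity)]
  push_cast
  calc ((c : ℝ) ^ m) ^ a * ((m : ℝ) ^ (m - m / a) * 2 ^ ((a + 1) * m)) * (m : ℝ) ^ (m / a)
      = ((c : ℝ) ^ a * 2 ^ (a + 1)) ^ m * (m : ℝ) ^ m := by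
        rw [← h_split, mul_pow, pow_mul, pow_right_comm (c : ℝ)]
        ring
    _ ≤ ((c : ℝ) ^ a * 2 ^ (a + 1)) ^ m * (m.factorial * Real.exp 1 ^ m) := by
        gcongr
        exact pow_self_le_factorial_mul_exp_pow m
    _ = (c ^ a * 2 ^ (a + 1) * Real.exp 1) ^ m * m.factorial := by ring

theorem tendsto_probAut_sub_equivariantProbAut {N : ℕ → Type*} [∀ m, CommGroup (N m)]
    [∀ m, Finite (N m)] (act : ∀ m, Perm (Fin m) →* MulAut (N m)) {a c : ℕ} (hc : 0 < c)
    (hN : ∀ m, Nat.card (N m) ≤ c ^ m)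
    (ha : ∀ᶠ m in atTop,
      Nat.card (NormalClosureQuotient (act m) (alternatingGroup (Fin m))) ≤ a) :
    Tendsto (fun m => probAut (N m ⋊[act m] Perm (Fin m)) - equivariantProbAut (act m))
      atTop (𝓝 0) := by
  have ha_pos : 0 < a := let ⟨_, hm⟩ := ha.exists; Nat.card_pos.trans_le hm
  have hL : (1 : ℝ) ≤ c ^ a * 2 ^ (a + 1) * Real.exp 1 := by
    have hca : (1 : ℝ) ≤ c ^ a := one_le_pow₀ (mod_cast hc)
    have h2a : (1 : ℝ) ≤ 2 ^ (a + 1) := one_le_pow₀ one_le_two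
    exact one_le_mul_of_one_le_of_one_le (one_le_mul_of_one_le_of_one_le hca h2a)
      (Real.one_le_exp zero_le_one)
  refine squeeze_zero_norm' ?_ (tendsto_pow_div_pow_div hL ha_pos)
  filter_upwards [ha, eventually_ge_atTop 7] with m ham hm
  have hm_pos : 0 < m := by omega
  have h_card : Nat.card {φ : N m ⋊[act m] Perm (Fin m) →* N m ⋊[act m] Perm (Fin m) //
      alternatingGroup (Fin m) ≤ (φ.comp inr).ker} ≤
        (c ^ m) ^ a * (m ^ (m - m / a) * 2 ^ ((a + 1) * m)) := by
    refine (card_hom_trivial_on_le _).trans ?_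
    simpa only [Fintype.card_fin] using card_hom_semidirectProduct_perm_le (X := Fin m) ham
      (by rw [Fintype.card_fin]; exact hN m)
  refine (abs_probAut_sub_equivariantProbAut_le
    (isPerfectMonolith_alternatingGroup (α := Fin m) (by simp; omega))
    (conj_surjective_of_seven_le_card (by simpa using hm))).trans ?_
  refine le_trans ?_ (card_bound_div_factorial_le hm_pos)
  rw [Nat.card_perm, Nat.card_fin]
  gcongr

end Limit

section Coordinates

variable {α M : Type*} [CommGroup M]

/-- The action of the permutations of `α` on the vectors with entries in `M`, by permuting the
coordinates. -/
abbrev coordAct (α M : Type*) [CommGroup M] : Perm α →* MulAut (α → M) := mulAutArrow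

lemma coordAct_apply (σ : Perm α) (v : α → M) (i : α) : coordAct α M σ v i = v (σ⁻¹ i) := rfl

lemma coordAct_mulSingle [DecidableEq α] (σ : Perm α) (i : α) (u : M) :
    coordAct α M σ (Pi.mulSingle i u) = Pi.mulSingle (σ i) u :=
  Pi.mulSingle_comp_equiv σ⁻¹ i u

lemma equivariantEnd_mulSingle_apply [DecidableEq α] (θ : EquivariantEnd (coordAct α M))
    (σ : Perm α) (i k : α) (u : M) :
    θ.1 (Pi.mulSingle (σ i) u) (σ k) = θ.1 (Pi.mulSingle i u) k := by
  rw [← coordAct_mulSingle, θ.2, coordAct_apply, Perm.inv_def, symm_apply_apply]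

variable [Fintype α]

/-- The product of the entries of a vector. -/
def coordProd (α M : Type*) [CommGroup M] [Fintype α] : (α → M) →* M :=
  ∏ i, Pi.evalMonoidHom (fun _ => M) i

lemma coordProd_apply (v : α → M) : coordProd α M v = ∏ i, v i :=
  MonoidHom.finsetProd_apply _ _ _

lemma coordProd_coordAct (σ : Perm α) (v : α → M) :
    coordProd α M (coordAct α M σ v) = coordProd α M v := by
  rw [coordProd_apply, coordProd_apply]
  exact Equiv.prod_comp σ⁻¹ v

lemma coordProd_mulSingle [DecidableEq α] (i : α) (u : M) :
    coordProd α M (Pi.mulSingle i u) = u := by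
  rw [coordProd_apply, Fintype.prod_pi_mulSingle']

lemma coordProd_const (u : M) : coordProd α M (fun _ => u) = u ^ Fintype.card α := by
  rw [coordProd_apply, Finset.prod_const, Finset.card_univ]

/-- The equivariant endomorphism `v ↦ (i ↦ f (v i) * g (∏ j, v j))`. -/
def endOfHoms (x : (M →* M) × (M →* M)) : EquivariantEnd (coordAct α M) :=
  ⟨x.1.compLeft α * MonoidHom.pi fun _ => x.2.comp (coordProd α M), fun σ v => by
    funext i
    change x.1 (v (σ⁻¹ i)) * x.2 (coordProd α M (coordAct α M σ v)) =
      x.1 (v (σ⁻¹ i)) * x.2 (coordProd α M v)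
    rw [coordProd_coordAct]⟩

lemma endOfHoms_apply (x : (M →* M) × (M →* M)) (v : α → M) (i : α) :
    (endOfHoms x).1 v i = x.1 (v i) * x.2 (coordProd α M v) := rfl

lemma coordProd_endOfHoms (x : (M →* M) × (M →* M)) (v : α → M) :
    coordProd α M ((endOfHoms x).1 v) =
      x.1 (coordProd α M v) * x.2 (coordProd α M v) ^ Fintype.card α := by
  rw [coordProd_apply]
  simp only [endOfHoms_apply]
  rw [Finset.prod_mul_distrib, ← map_prod, ← coordProd_apply, Finset.prod_const, Finset.card_univ]

lemma endOfHoms_mulSingle_self [DecidableEq α] (x : (M →* M) × (M →* M)) (i : α) (u : M) :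
    (endOfHoms x).1 (Pi.mulSingle i u) i = x.1 u * x.2 u := by
  rw [endOfHoms_apply, coordProd_mulSingle, Pi.mulSingle_eq_same]

lemma endOfHoms_mulSingle_of_ne [DecidableEq α] (x : (M →* M) × (M →* M)) {i k : α}
    (h : k ≠ i) (u : M) :
    (endOfHoms x).1 (Pi.mulSingle i u) k = x.2 u := by
  rw [endOfHoms_apply, coordProd_mulSingle, Pi.mulSingle_eq_of_ne h, map_one, one_mul]

lemma endOfHoms_bijective [Nontrivial α] : Function.Bijective (endOfHoms (α := α) (M := M)) := by
  classical
  obtain ⟨o, p, hop⟩ := exists_pair_ne α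
  constructor
  · intro x y h
    have h_snd (u : M) : x.2 u = y.2 u := by
      rw [← endOfHoms_mulSingle_of_ne x hop.symm, h, endOfHoms_mulSingle_of_ne y hop.symm]
    have h_fst (u : M) : x.1 u = y.1 u := by
      have := endOfHoms_mulSingle_self x o u
      rwa [h, endOfHoms_mulSingle_self, h_snd, mul_left_inj, eq_comm] at this
    exact Prod.ext (MonoidHom.ext h_fst) (MonoidHom.ext h_snd)
  · intro θ
    let entry (k : α) : M →* M :=
      ((Pi.evalMonoidHom _ k).comp θ.1).comp (MonoidHom.mulSingle (fun _ => M) o)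
    refine ⟨(entry o / entry p, entry p), Subtype.ext ?_⟩
    refine MonoidHom.functions_ext _ _ _ fun i u => funext fun k => ?_
    by_cases hk : k = i
    · subst hk
      rw [endOfHoms_mulSingle_self, MonoidHom.div_apply, div_mul_cancel]
      have := equivariantEnd_mulSingle_apply θ (swap o k) o o u
      rw [swap_apply_left] at this
      exact this.symm
    · obtain ⟨σ, rfl, rfl⟩ := MulAction.is_two_pretransitive_iff.mp
        (Perm.isMultiplyPretransitive α 2) hop (Ne.symm hk)
      rw [endOfHoms_mulSingle_of_ne _ hk]
      exact (equivariantEnd_mulSingle_apply θ σ o p u).symm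

lemma bijective_endOfHoms_iff [Nontrivial α] [Finite M] (x : (M →* M) × (M →* M)) :
    Function.Bijective (endOfHoms (α := α) x).1 ↔
      Function.Injective x.1 ∧ ∀ u, x.1 u * x.2 u ^ Fintype.card α = 1 → u = 1 := by
  rw [← Finite.injective_iff_bijective, injective_iff_map_eq_one]
  constructor
  · intro h
    have h_fst : Function.Injective x.1 := by
      classical
      obtain ⟨o, p, hop⟩ := exists_pair_ne α
      refine (injective_iff_map_eq_one _).mpr fun u hu => ?_
      have h_one := h (Pi.mulSingle o u / Pi.mulSingle p u) <| funext fun k => by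
        rw [endOfHoms_apply, map_div, coordProd_mulSingle, coordProd_mulSingle, div_self',
          map_one, mul_one, Pi.div_apply, map_div, Pi.mulSingle_apply, Pi.mulSingle_apply]
        split_ifs <;> simp [hu]
      simpa [hop] using congrFun h_one o
    refine ⟨h_fst, fun u hu => ?_⟩
    obtain ⟨c, hc⟩ := Finite.surjective_of_injective h_fst (x.2 u)⁻¹
    have h_pow : c ^ Fintype.card α = u := h_fst <| by
      rw [map_pow, hc, inv_pow, inv_eq_iff_mul_eq_one, mul_comm, hu]
    have h_one := h (fun _ => c) <| funext fun k => by
      rw [endOfHoms_apply, coordProd_const, h_pow, hc, inv_mul_cancel, Pi.one_apply]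
    rw [← h_pow, ← coordProd_const, h_one, map_one]
  · rintro ⟨h_fst, h_prod⟩ v hv
    have h_one : coordProd α M v = 1 := h_prod _ <| by rw [← coordProd_endOfHoms, hv, map_one]
    refine funext fun i => (injective_iff_map_eq_one _).mp h_fst _ ?_
    have := congrFun hv i
    rwa [endOfHoms_apply, h_one, map_one, mul_one] at this

lemma inl_mem_normalClosure_alternatingGroup_of_coordProd_eq_one [DecidableEq α]
    (hα : 3 ≤ Nat.card α)
    {v : α → M} (hv : v ∈ (coordProd α M).ker) :
    inl v ∈ Subgroup.normalClosure
      (inr '' (alternatingGroup α : Set (Perm α)) : Set ((α → M) ⋊[coordAct α M] Perm α)) := by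
  obtain ⟨o⟩ : Nonempty α := Finite.card_pos_iff.mp (by omega)
  let r : (α → M) →* (α → M) :=
    MonoidHom.id _ / (MonoidHom.mulSingle (fun _ => M) o).comp (coordProd α M)
  have hr : r v = v := by simp [r, MonoidHom.mem_ker.mp hv]
  rw [← hr]
  refine Subgroup.pi_mem_of_mulSingle_mem (H := (Subgroup.normalClosure _).comap (inl.comp r)) v
    fun i => ?_
  have := alternatingGroup.isPretransitive_of_three_le_card α hα
  obtain ⟨σ, hσ⟩ := MulAction.exists_smul_eq (alternatingGroup α) i o
  have h_single : r (Pi.mulSingle i (v i)) =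
      Pi.mulSingle i (v i) / coordAct α M σ (Pi.mulSingle i (v i)) := by
    rw [coordAct_mulSingle]
    simp [r, coordProd_mulSingle, ← hσ, Subgroup.smul_def]
  rw [Subgroup.mem_comap, MonoidHom.comp_apply, h_single]
  exact inl_div_act_mem_normalClosure σ.2 _

lemma card_normalClosureQuotient_coordAct_le [DecidableEq α] [Finite M]
    (hα : 3 ≤ Nat.card α) :
    Nat.card (NormalClosureQuotient (coordAct α M) (alternatingGroup α)) ≤ Nat.card M * 2 := by
  simpa using card_normalClosureQuotient_le (coordProd α M) coordProd_coordAct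
    (fun v => inl_mem_normalClosure_alternatingGroup_of_coordProd_eq_one hα) sign le_rfl

end Coordinates

section Signs

lemma monoidHom_units_int_eq_one_or_id (f : ℤˣ →* ℤˣ) : f = 1 ∨ f = MonoidHom.id ℤˣ := by
  have h_ext {g : ℤˣ →* ℤˣ} (h : f (-1) = g (-1)) : f = g := MonoidHom.ext fun u => by
    rcases Int.units_eq_one_or u with rfl | rfl
    exacts [(map_one f).trans (map_one g).symm, h]
  exact (Int.units_eq_one_or (f (-1))).imp (fun h => h_ext h) (fun h => h_ext h)

lemma one_ne_id_units_int : (1 : ℤˣ →* ℤˣ) ≠ MonoidHom.id ℤˣ := fun h =>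
  absurd (DFunLike.congr_fun h (-1)) (by decide)

lemma card_monoidHom_units_int : Nat.card (ℤˣ →* ℤˣ) = 2 :=
  Nat.card_eq_two_iff.mpr ⟨1, MonoidHom.id ℤˣ, one_ne_id_units_int,
    Set.eq_univ_of_forall monoidHom_units_int_eq_one_or_id⟩

lemma injective_units_int_iff (f : ℤˣ →* ℤˣ) : Function.Injective f ↔ f = MonoidHom.id ℤˣ := by
  refine ⟨fun h => (monoidHom_units_int_eq_one_or_id f).resolve_left ?_, ?_⟩
  · rintro rfl
    exact absurd (@h (-1) 1 rfl) (by decide)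
  · rintro rfl
    exact Function.injective_id

variable {α : Type*} [Fintype α] [Nontrivial α]

lemma equivariantProbAut_signs {p : (ℤˣ →* ℤˣ) × (ℤˣ →* ℤˣ) → Prop}
    (hp : ∀ x, Function.Bijective (endOfHoms (α := α) x).1 ↔ p x) :
    equivariantProbAut (coordAct α ℤˣ) = Nat.card {x // p x} / 4 := by
  let E : (ℤˣ →* ℤˣ) × (ℤˣ →* ℤˣ) ≃ EquivariantEnd (coordAct α ℤˣ) :=
    .ofBijective _ endOfHoms_bijective
  rw [equivariantProbAut, ← Nat.card_congr E,
    ← Nat.card_congr (E.subtypeEquiv fun x => (hp x).symm), Nat.card_prod,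
    card_monoidHom_units_int]
  norm_num

lemma equivariantProbAut_signs_of_even (hα : Even (Fintype.card α)) :
    equivariantProbAut (coordAct α ℤˣ) = 1 / 2 := by
  have h_iff (x : (ℤˣ →* ℤˣ) × (ℤˣ →* ℤˣ)) :
      Function.Bijective (endOfHoms (α := α) x).1 ↔ x.1 = MonoidHom.id ℤˣ := by
    rw [bijective_endOfHoms_iff, injective_units_int_iff, and_iff_left_iff_imp]
    intro hx u hu
    rwa [hx, ← map_pow, Int.units_pow_eq_pow_mod_two, Nat.even_iff.mp hα, pow_zero, map_one,
      mul_one] at hu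
  rw [equivariantProbAut_signs h_iff,
    Nat.card_congr (prodSubtypeFstEquivSubtypeProd (p := (· = MonoidHom.id ℤˣ))), Nat.card_prod,
    card_monoidHom_units_int]
  norm_num

lemma equivariantProbAut_signs_of_odd (hα : Odd (Fintype.card α)) :
    equivariantProbAut (coordAct α ℤˣ) = 1 / 4 := by
  have h_iff (x : (ℤˣ →* ℤˣ) × (ℤˣ →* ℤˣ)) :
      Function.Bijective (endOfHoms (α := α) x).1 ↔ x = (MonoidHom.id ℤˣ, 1) := by
    obtain ⟨f, g⟩ := x
    rw [bijective_endOfHoms_iff, injective_units_int_iff, Prod.mk.injEq]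
    refine and_congr_right fun hf => ?_
    subst hf
    rcases monoidHom_units_int_eq_one_or_id g with rfl | rfl
    · simp
    · simp only [one_ne_id_units_int.symm, iff_false]
      intro h
      exact absurd (h (-1) (by simp [hα.neg_one_pow])) (by decide)
  rw [equivariantProbAut_signs h_iff, Nat.card_unique]
  norm_num

lemma tendsto_probAut_signs_sub_ite :
    Tendsto (fun m => probAut ((Fin m → ℤˣ) ⋊[coordAct (Fin m) ℤˣ] Perm (Fin m)) -
      if Even m then 1 / 2 else 1 / 4) atTop (𝓝 0) := by
  have h_quotient : ∀ᶠ m in atTop,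
      Nat.card (NormalClosureQuotient (coordAct (Fin m) ℤˣ) (alternatingGroup (Fin m))) ≤ 4 := by
    filter_upwards [eventually_ge_atTop 3] with m hm
    simpa using card_normalClosureQuotient_coordAct_le (α := Fin m) (M := ℤˣ) (by simpa using hm)
  refine (tendsto_probAut_sub_equivariantProbAut (fun m => coordAct (Fin m) ℤˣ) two_pos
    (fun m => by simp) h_quotient).congr' ?_
  filter_upwards [eventually_ge_atTop 2] with m hm
  have : Nontrivial (Fin m) := Fin.nontrivial_iff_two_le.mpr hm
  split_ifs with h
  · rw [equivariantProbAut_signs_of_even (by simpa using h)]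
  · rw [equivariantProbAut_signs_of_odd (by simpa using h)]

end Signs

section EvenSigns

variable {α : Type*} [Fintype α]

/-- The sign vectors with an even number of negative entries. -/
abbrev evenSigns (α : Type*) [Fintype α] : Subgroup (α → ℤˣ) := (coordProd α ℤˣ).ker

/-- The action of the permutations of `α` on the even sign vectors, by permuting the
coordinates. -/
def evenSignAct (α : Type*) [Fintype α] : Perm α →* MulAut (evenSigns α) where
  toFun σ :=
    { toFun v := ⟨coordAct α ℤˣ σ v, (coordProd_coordAct σ v.1).trans v.2⟩
      invFun v := ⟨coordAct α ℤˣ σ⁻¹ v, (coordProd_coordAct σ⁻¹ v.1).trans v.2⟩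
      left_inv v := by ext1; simp
      right_inv v := by ext1; simp
      map_mul' v w := by ext1; simp }
  map_one' := by ext1 v; ext1; simp
  map_mul' σ τ := by ext1 v; ext1; simp

lemma coe_evenSignAct (σ : Perm α) (v : evenSigns α) :
    (evenSignAct α σ v : α → ℤˣ) = coordAct α ℤˣ σ v := rfl

variable [DecidableEq α]

/-- The sign vector with negative entries at `i` and `j`, which is `1` if `i = j`. -/
def pairSign (i j : α) : evenSigns α :=
  ⟨Pi.mulSingle i (-1) * Pi.mulSingle j (-1), by
    rw [MonoidHom.mem_ker, map_mul, coordProd_mulSingle, coordProd_mulSingle, Int.units_mul_self]⟩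

lemma coe_pairSign (i j : α) :
    (pairSign i j : α → ℤˣ) = Pi.mulSingle i (-1) * Pi.mulSingle j (-1) := rfl

lemma evenSignAct_pairSign (σ : Perm α) (i j : α) :
    evenSignAct α σ (pairSign i j) = pairSign (σ i) (σ j) := by
  ext1
  rw [coe_evenSignAct, coe_pairSign, map_mul, coordAct_mulSingle, coordAct_mulSingle, coe_pairSign]

lemma pairSign_comm (i j : α) : pairSign i j = pairSign j i :=
  Subtype.ext (mul_comm _ _)

lemma pairSign_mul_pairSign (i j k : α) : pairSign i j * pairSign j k = pairSign i k := by
  have : (Pi.mulSingle j (-1) : α → ℤˣ) * Pi.mulSingle j (-1) = 1 := by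
    rw [← Pi.mulSingle_mul, Int.units_mul_self, Pi.mulSingle_one]
  ext1
  rw [Subgroup.coe_mul, coe_pairSign, coe_pairSign, coe_pairSign, mul_assoc,
    ← mul_assoc (Pi.mulSingle j (-1)), this, one_mul]

lemma pairSign_apply_left {i j : α} (h : i ≠ j) : (pairSign i j).1 i = -1 := by
  simp [coe_pairSign, h]

lemma pairSign_apply_of_ne {i j k : α} (hi : k ≠ i) (hj : k ≠ j) : (pairSign i j).1 k = 1 := by
  simp [coe_pairSign, hi, hj]

lemma mem_of_pairSign_mem {H : Subgroup (evenSigns α)} (h : ∀ i j, i ≠ j → pairSign i j ∈ H)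
    (v : evenSigns α) : v ∈ H := by
  rcases isEmpty_or_nonempty α with hα | ⟨⟨o⟩⟩
  · rw [Subsingleton.elim v 1]
    exact one_mem H
  let r : (α → ℤˣ) →* evenSigns α :=
    (MonoidHom.id _ * (MonoidHom.mulSingle (fun _ => ℤˣ) o).comp (coordProd α ℤˣ)).codRestrict _
      fun v => by simp [coordProd_mulSingle, MonoidHom.mem_ker, Int.units_mul_self]
  have hr : r v = v := by
    ext1
    simp [r, MonoidHom.mem_ker.mp v.2]
  have hr_single (i : α) : r (Pi.mulSingle i (-1)) = pairSign i o := by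
    ext1
    simp [r, coordProd_mulSingle, coe_pairSign]
  rw [← hr]
  refine Subgroup.pi_mem_of_mulSingle_mem (H := H.comap r) v.1 fun i => ?_
  rw [Subgroup.mem_comap]
  rcases Int.units_eq_one_or (v.1 i) with hv | hv
  · rw [hv, Pi.mulSingle_one, map_one]
    exact one_mem H
  · rw [hv, hr_single]
    by_cases hi : i = o
    · have : pairSign o o = 1 := mul_eq_left.mp (pairSign_mul_pairSign o o o)
      rw [hi, this]
      exact one_mem H
    · exact h i o hi

lemma equivariantEnd_pairSign_apply (θ : EquivariantEnd (evenSignAct α)) (σ : Perm α)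
    (i j k : α) : (θ.1 (pairSign (σ i) (σ j))).1 (σ k) = (θ.1 (pairSign i j)).1 k := by
  rw [← evenSignAct_pairSign, θ.2, coe_evenSignAct, coordAct_apply, Perm.inv_def, symm_apply_apply]

lemma equivariantEnd_pairSign_apply_of_ne (hα : 4 ≤ Fintype.card α)
    (θ : EquivariantEnd (evenSignAct α)) {i j k : α} (hij : i ≠ j) (hki : k ≠ i) (hkj : k ≠ j) :
    (θ.1 (pairSign i j)).1 k = 1 := by
  obtain ⟨l, hl⟩ : ∃ l, l ∉ ({i, j, k} : Finset α) := by
    by_contra! h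
    have := (Finset.card_le_card fun l _ => h l : #Finset.univ ≤ _).trans Finset.card_le_three
    rw [Finset.card_univ] at this
    omega
  simp only [Finset.mem_insert, Finset.mem_singleton, not_or] at hl
  obtain ⟨hli, hlj, hlk⟩ := hl
  have h_left : (θ.1 (pairSign i l)).1 k = (θ.1 (pairSign i j)).1 k := by
    have := equivariantEnd_pairSign_apply θ (swap j l) i j k
    rwa [swap_apply_of_ne_of_ne hij (Ne.symm hli), swap_apply_left,
      swap_apply_of_ne_of_ne hkj (Ne.symm hlk)] at this
  have h_right : (θ.1 (pairSign l j)).1 k = (θ.1 (pairSign i j)).1 k := by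
    have := equivariantEnd_pairSign_apply θ (swap i l) i j k
    rwa [swap_apply_left, swap_apply_of_ne_of_ne hij.symm (Ne.symm hlj),
      swap_apply_of_ne_of_ne hki (Ne.symm hlk)] at this
  have h_mul := congrArg (fun v => (θ.1 v).1 k) (pairSign_mul_pairSign i l j)
  simpa [h_left, h_right] using h_mul.symm

lemma equivariantEnd_pairSign_eq_one_or_self (hα : 4 ≤ Fintype.card α)
    (θ : EquivariantEnd (evenSignAct α)) {i j : α} (hij : i ≠ j) :
    θ.1 (pairSign i j) = 1 ∨ θ.1 (pairSign i j) = pairSign i j := by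
  have h_symm : (θ.1 (pairSign i j)).1 j = (θ.1 (pairSign i j)).1 i := by
    have := equivariantEnd_pairSign_apply θ (swap i j) i j i
    rwa [swap_apply_left, swap_apply_right, pairSign_comm] at this
  have h_ext {v : evenSigns α} (hi : (θ.1 (pairSign i j)).1 i = v.1 i) (hj : v.1 j = v.1 i)
      (hv : ∀ k, k ≠ i → k ≠ j → v.1 k = 1) : θ.1 (pairSign i j) = v := by
    refine Subtype.ext (funext fun k => ?_)
    rcases eq_or_ne k i with rfl | hki
    · exact hi
    rcases eq_or_ne k j with rfl | hkj
    · rw [h_symm, hi, hj]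
    · rw [equivariantEnd_pairSign_apply_of_ne hα θ hij hki hkj, hv k hki hkj]
  refine (Int.units_eq_one_or _).imp (fun h => h_ext h rfl fun _ _ _ => rfl)
    (fun h => h_ext ?_ ?_ ?_)
  · rw [h, pairSign_apply_left hij]
  · rw [pairSign_comm, pairSign_apply_left hij.symm, pairSign_comm, pairSign_apply_left hij]
  · exact fun k => pairSign_apply_of_ne

omit [DecidableEq α] in
lemma equivariantEnd_evenSigns_eq_one_or_id (hα : 4 ≤ Fintype.card α)
    (θ : EquivariantEnd (evenSignAct α)) : θ.1 = 1 ∨ θ.1 = MonoidHom.id _ := by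
  classical
  have : Nontrivial α := Fintype.one_lt_card_iff_nontrivial.mp (by omega)
  obtain ⟨o, p, hop⟩ := exists_pair_ne α
  have h_ext {ψ : EquivariantEnd (evenSignAct α)} (h : θ.1 (pairSign o p) = ψ.1 (pairSign o p)) :
      θ.1 = ψ.1 := by
    refine MonoidHom.ext (mem_of_pairSign_mem (H := θ.1.eqLocus ψ.1) fun i j hij => ?_)
    obtain ⟨σ, rfl, rfl⟩ := MulAction.is_two_pretransitive_iff.mp
      (Perm.isMultiplyPretransitive α 2) hop hij
    change θ.1 (pairSign (σ o) (σ p)) = ψ.1 (pairSign (σ o) (σ p))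
    rw [← evenSignAct_pairSign, θ.2, ψ.2, h]
  exact (equivariantEnd_pairSign_eq_one_or_self hα θ hop).imp
    (fun h => h_ext (ψ := ⟨1, fun _ _ => (map_one _).symm⟩) h)
    (fun h => h_ext (ψ := ⟨MonoidHom.id _, fun _ _ => rfl⟩) h)

omit [DecidableEq α] in
lemma equivariantProbAut_evenSigns (hα : 4 ≤ Fintype.card α) :
    equivariantProbAut (evenSignAct α) = 1 / 2 := by
  classical
  let θ₀ : EquivariantEnd (evenSignAct α) := ⟨1, fun _ _ => (map_one _).symm⟩
  let θ₁ : EquivariantEnd (evenSignAct α) := ⟨MonoidHom.id _, fun _ _ => rfl⟩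
  have h_cases (θ) : θ = θ₀ ∨ θ = θ₁ :=
    (equivariantEnd_evenSigns_eq_one_or_id hα θ).imp Subtype.ext Subtype.ext
  have h_not_injective : ¬ Function.Injective θ₀.1 := by
    intro h
    have : Nontrivial α := Fintype.one_lt_card_iff_nontrivial.mp (by omega)
    obtain ⟨o, p, hop⟩ := exists_pair_ne α
    have h_one : pairSign o p = 1 := h rfl
    have := pairSign_apply_left hop
    rw [h_one] at this
    exact absurd this (show (1 : ℤˣ) ≠ -1 by decide)
  have h_card : Nat.card (EquivariantEnd (evenSignAct α)) = 2 :=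
    Nat.card_eq_two_iff.mpr ⟨θ₀, θ₁, fun h => h_not_injective (h ▸ Function.injective_id),
      Set.eq_univ_of_forall h_cases⟩
  have h_card_bijective :
      Nat.card {θ : EquivariantEnd (evenSignAct α) // Function.Bijective θ.1} = 1 := by
    refine Nat.card_eq_one_iff_exists.mpr ⟨⟨θ₁, Function.bijective_id⟩, fun ⟨θ, hθ⟩ => ?_⟩
    exact Subtype.ext ((h_cases θ).resolve_left fun h => h_not_injective (h ▸ hθ.1))
  rw [equivariantProbAut, h_card, h_card_bijective]
  norm_num

lemma inl_evenSigns_mem_normalClosure_alternatingGroup (hα : 4 ≤ Fintype.card α)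
    (v : evenSigns α) :
    inl v ∈ Subgroup.normalClosure
      (inr '' (alternatingGroup α : Set (Perm α)) : Set (evenSigns α ⋊[evenSignAct α] Perm α)) := by
  refine mem_of_pairSign_mem (H := (Subgroup.normalClosure _).comap inl) (fun i j _ => ?_) v
  have : MulAction.IsMultiplyPretransitive (alternatingGroup α) α (Nat.card α - 2) :=
    alternatingGroup.isMultiplyPretransitive α
  have h_transitive : MulAction.IsMultiplyPretransitive (alternatingGroup α) α 2 :=
    MulAction.isMultiplyPretransitive_of_le (n := Nat.card α - 2)
      (by rw [Nat.card_eq_fintype_card]; omega) (by omega)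
  obtain ⟨k, hk⟩ : ∃ k, k ∉ ({i, j} : Finset α) := by
    by_contra! h
    have := (Finset.card_le_card fun k _ => h k : #Finset.univ ≤ _).trans Finset.card_le_two
    rw [Finset.card_univ] at this
    omega
  simp only [Finset.mem_insert, Finset.mem_singleton, not_or] at hk
  obtain ⟨σ, hσi, hσk⟩ := MulAction.is_two_pretransitive_iff.mp h_transitive
    (Ne.symm hk.1) (Ne.symm hk.2)
  have h_div : pairSign i k / evenSignAct α σ (pairSign i k) = pairSign i j := by
    rw [evenSignAct_pairSign, div_eq_iff_eq_mul, ← Perm.smul_def, ← Subgroup.smul_def, hσi,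
      ← Perm.smul_def, ← Subgroup.smul_def, hσk, pairSign_mul_pairSign]
  rw [Subgroup.mem_comap, ← h_div]
  exact inl_div_act_mem_normalClosure σ.2 _

lemma card_normalClosureQuotient_evenSignAct_le (hα : 4 ≤ Fintype.card α) :
    Nat.card (NormalClosureQuotient (evenSignAct α) (alternatingGroup α)) ≤ 2 := by
  simpa using card_normalClosureQuotient_le (1 : evenSigns α →* Unit) (fun _ _ => rfl)
    (fun v _ => inl_evenSigns_mem_normalClosure_alternatingGroup hα v) sign le_rfl

lemma tendsto_probAut_evenSigns :
    Tendsto (fun m => probAut (evenSigns (Fin m) ⋊[evenSignAct (Fin m)] Perm (Fin m)))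
      atTop (𝓝 (1 / 2)) := by
  have h_card (m : ℕ) : Nat.card (evenSigns (Fin m)) ≤ 2 ^ m := by
    simpa using Nat.card_le_card_of_injective _ (evenSigns (Fin m)).subtype_injective
  have h_quotient : ∀ᶠ m in atTop,
      Nat.card (NormalClosureQuotient (evenSignAct (Fin m)) (alternatingGroup (Fin m))) ≤ 2 := by
    filter_upwards [eventually_ge_atTop 4] with m hm
    exact card_normalClosureQuotient_evenSignAct_le (by simpa using hm)
  rw [← tendsto_sub_nhds_zero_iff]
  refine (tendsto_probAut_sub_equivariantProbAut (fun m => evenSignAct (Fin m)) two_pos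
    h_card h_quotient).congr' ?_
  filter_upwards [eventually_ge_atTop 4] with m hm
  rw [equivariantProbAut_evenSigns (by simpa using hm)]

end EvenSigns

section Unit

lemma equivariantProbAut_unit {P : Type*} [Group P] (act : P →* MulAut Unit) :
    equivariantProbAut act = 1 := by
  have : Unique (EquivariantEnd act) :=
    ⟨⟨⟨1, fun _ _ => rfl⟩⟩, fun _ => Subtype.ext (Subsingleton.elim _ _)⟩
  have h_bijective (θ : EquivariantEnd act) : Function.Bijective θ.1 :=
    Function.bijective_id
  rw [equivariantProbAut, Nat.card_congr (Equiv.subtypeUnivEquiv h_bijective), Nat.card_unique]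
  norm_num

lemma tendsto_probAut_unit_perm :
    Tendsto (fun m => probAut (Unit ⋊[(1 : Perm (Fin m) →* MulAut Unit)] Perm (Fin m)))
      atTop (𝓝 1) := by
  have h_quotient (m : ℕ) : Nat.card (NormalClosureQuotient (1 : Perm (Fin m) →* MulAut Unit)
      (alternatingGroup (Fin m))) ≤ 2 := by
    simpa [alternatingGroup] using card_normalClosureQuotient_le
      (act := (1 : Perm (Fin m) →* MulAut Unit)) (K := alternatingGroup (Fin m))
      (MonoidHom.id Unit) (fun _ _ => rfl) (fun _ _ => one_mem _) sign le_rfl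
  rw [← tendsto_sub_nhds_zero_iff]
  simpa only [equivariantProbAut_unit] using
    tendsto_probAut_sub_equivariantProbAut (fun m => (1 : Perm (Fin m) →* MulAut Unit)) one_pos
      (fun m => by simp) (.of_forall h_quotient)

end Unit

section Geometry

variable {α : Type*} [Fintype α]

/-- The isometry of Euclidean space that changes the signs of the coordinates according to `v`. -/
noncomputable def signIsometry (v : α → ℤˣ) : EuclideanSpace ℝ α ≃ₗᵢ[ℝ] EuclideanSpace ℝ α :=
  LinearIsometryEquiv.piLpCongrRight 2 fun i =>
    ⟨DistribMulAction.toLinearEquiv ℝ ℝ (v i), fun x => by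
      rcases Int.units_eq_one_or (v i) with h | h <;> simp [h]⟩

/-- The action of the signed permutations on Euclidean space. -/
noncomputable def signedPermIsometry (α : Type*) [Fintype α] :
    (α → ℤˣ) ⋊[coordAct α ℤˣ] Perm α →* (EuclideanSpace ℝ α ≃ₗᵢ[ℝ] EuclideanSpace ℝ α) where
  toFun g := signIsometry g.left * LinearIsometryEquiv.piLpCongrLeft 2 ℝ ℝ g.right
  map_one' := by
    ext x i
    exact one_smul ℤˣ (x i)
  map_mul' g h := by
    ext x i
    exact mul_smul (g.left i) (h.left (g.right⁻¹ i)) (x ((g.right * h.right)⁻¹ i))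

lemma signedPermIsometry_apply (g : (α → ℤˣ) ⋊[coordAct α ℤˣ] Perm α) (x : EuclideanSpace ℝ α)
    (i : α) : signedPermIsometry α g x i = g.left i • x (g.right⁻¹ i) := rfl

lemma signedPermIsometry_inl_apply (v : α → ℤˣ) (x : EuclideanSpace ℝ α) (i : α) :
    signedPermIsometry α (inl v) x i = v i • x i := rfl

lemma signedPermIsometry_injective : Function.Injective (signedPermIsometry α) := by
  classical
  refine (injective_iff_map_eq_one _).mpr fun g hg => ?_
  have h_single (i : α) :
      g.left i • EuclideanSpace.single i (1 : ℝ) (g.right⁻¹ i) = 1 := by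
    rw [← signedPermIsometry_apply, hg]
    simp
  have h_right : g.right = 1 := by
    rw [← inv_eq_one]
    ext1 i
    by_contra h
    have := h_single i
    rw [PiLp.single_apply, if_neg (show g.right⁻¹ i ≠ i from h), smul_zero] at this
    exact zero_ne_one this
  refine SemidirectProduct.ext (funext fun i => ?_) h_right
  have := h_single i
  rw [h_right, inv_one, one_apply, PiLp.single_apply, if_pos rfl] at this
  rcases Int.units_eq_one_or (g.left i) with h | h
  · exact h
  · norm_num [h] at this

variable {n : ℕ}

lemma inner_e_left (i : Fin n) (x : EuclideanSpace ℝ (Fin n)) : inner ℝ (e i) x = x i := by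
  simp [e, EuclideanSpace.inner_single_left]

lemma reflection_orthogonal_span_singleton_apply (v x : EuclideanSpace ℝ (Fin n)) (i : Fin n) :
    (Submodule.span ℝ {v})ᗮ.reflection x i = x i - 2 * (inner ℝ v x / ‖v‖ ^ 2) * v i := by
  rw [Submodule.reflection_orthogonal_apply, Submodule.reflection_singleton_apply]
  simp
  ring

lemma reflection_e (i : Fin n) :
    (Submodule.span ℝ {e i})ᗮ.reflection =
      signedPermIsometry (Fin n) (inl (Pi.mulSingle i (-1))) := by
  ext x k
  rw [reflection_orthogonal_span_singleton_apply, signedPermIsometry_inl_apply, inner_e_left]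
  rcases eq_or_ne k i with rfl | hk
  · simp [e]
    ring
  · simp [e, hk]

lemma reflection_e_sub_smul_e {i j : Fin n} (hij : i ≠ j) (u : ℤˣ) :
    (Submodule.span ℝ {e i - u • e j})ᗮ.reflection = signedPermIsometry (Fin n)
      (inl (Pi.mulSingle i u * Pi.mulSingle j u) * inr (swap i j)) := by
  have h_inner (x : EuclideanSpace ℝ (Fin n)) : inner ℝ (e i - u • e j) x = x i - u • x j := by
    rcases Int.units_eq_one_or u with rfl | rfl <;>
      simp [inner_sub_left, inner_add_left, inner_e_left]
  have h_norm : ‖e i - u • e j‖ ^ 2 = 2 := by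
    rw [← real_inner_self_eq_norm_sq, h_inner]
    rcases Int.units_eq_one_or u with rfl | rfl <;> norm_num [e, hij, hij.symm]
  ext x k
  rw [reflection_orthogonal_span_singleton_apply, h_norm, h_inner, signedPermIsometry_apply]
  rcases eq_or_ne k i with rfl | hki
  · rcases Int.units_eq_one_or u with rfl | rfl <;> simp [e, hij] <;> ring
  rcases eq_or_ne k j with rfl | hkj
  · rcases Int.units_eq_one_or u with rfl | rfl <;> simp [e, hki] <;> ring
  · simp [e, hki, hkj, swap_apply_of_ne_of_ne]

lemma reflection_e_sub {i j : Fin n} (hij : i ≠ j) :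
    (Submodule.span ℝ {e i - e j})ᗮ.reflection =
      signedPermIsometry (Fin n) (inr (swap i j)) := by
  simpa using reflection_e_sub_smul_e hij 1

lemma reflection_e_add {i j : Fin n} (hij : i ≠ j) :
    (Submodule.span ℝ {e i + e j})ᗮ.reflection =
      signedPermIsometry (Fin n) (inl (pairSign i j).1 * inr (swap i j)) := by
  simpa [coe_pairSign] using reflection_e_sub_smul_e hij (-1)

lemma reflection_mem_reflectionGroup {E : Type*} [NormedAddCommGroup E] [InnerProductSpace ℝ E]
    {Φ : Set E} {v : E} (hv : v ∈ Φ) :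
    (Submodule.span ℝ {v})ᗮ.reflection ∈ reflectionGroup Φ :=
  Subgroup.subset_closure ⟨v, hv, rfl⟩

lemma signedPermIsometry_inr_mem_reflectionGroup {Φ : Set (EuclideanSpace ℝ (Fin n))}
    (hΦ : ∀ i j, i ≠ j → e i - e j ∈ Φ) (σ : Perm (Fin n)) :
    signedPermIsometry (Fin n) (inr σ) ∈ reflectionGroup Φ := by
  have : Subgroup.closure {τ : Perm (Fin n) | τ.IsSwap} ≤
      (reflectionGroup Φ).comap ((signedPermIsometry (Fin n)).comp inr) := by
    rw [Subgroup.closure_le]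
    rintro _ ⟨i, j, hij, rfl⟩
    rw [SetLike.mem_coe, Subgroup.mem_comap, MonoidHom.comp_apply, ← reflection_e_sub hij]
    exact reflection_mem_reflectionGroup (hΦ i j hij)
  rw [closure_isSwap] at this
  exact this (Subgroup.mem_top σ)

lemma nonempty_reflectionGroup_mulEquiv {N : Type*} [Group N] {act : Perm (Fin n) →* MulAut N}
    {Φ : Set (EuclideanSpace ℝ (Fin n))} (f : N →* (Fin n → ℤˣ)) (hf : Function.Injective f)
    (h_act : ∀ σ v, f (act σ v) = coordAct (Fin n) ℤˣ σ (f v))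
    (h_sub : ∀ i j, i ≠ j → e i - e j ∈ Φ)
    (h_sign : ∀ v, signedPermIsometry (Fin n) (inl (f v)) ∈ reflectionGroup Φ)
    (h_reflection : ∀ r ∈ Φ, ∃ v σ, (Submodule.span ℝ {r})ᗮ.reflection =
      signedPermIsometry (Fin n) (inl (f v) * inr σ)) :
    Nonempty (reflectionGroup Φ ≃* N ⋊[act] Perm (Fin n)) := by
  let F : N ⋊[act] Perm (Fin n) →* (Fin n → ℤˣ) ⋊[coordAct (Fin n) ℤˣ] Perm (Fin n) :=
    SemidirectProduct.map f (MonoidHom.id _) fun σ => MonoidHom.ext (h_act σ)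
  have hF (v : N) (σ : Perm (Fin n)) : F (inl v * inr σ) = inl (f v) * inr σ := by
    rw [map_mul, map_inl, map_inr, MonoidHom.id_apply]
  have hF_injective : Function.Injective F := fun g h hgh => by
    rw [SemidirectProduct.ext_iff, map_left, map_left, map_right, map_right] at hgh
    exact SemidirectProduct.ext (hf hgh.1) hgh.2
  have h_range : reflectionGroup Φ = ((signedPermIsometry (Fin n)).comp F).range := by
    apply le_antisymm
    · rw [reflectionGroup, Subgroup.closure_le]
      rintro _ ⟨r, hr, rfl⟩
      obtain ⟨v, σ, h⟩ := h_reflection r hr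
      exact ⟨inl v * inr σ, by rw [MonoidHom.comp_apply, hF, h]⟩
    · rintro _ ⟨g, rfl⟩
      rw [← inl_left_mul_inr_right g, MonoidHom.comp_apply, hF, map_mul]
      exact mul_mem (h_sign _) (signedPermIsometry_inr_mem_reflectionGroup h_sub _)
  exact ⟨(MulEquiv.subgroupCongr h_range).trans
    (MonoidHom.ofInjective (f := (signedPermIsometry (Fin n)).comp F)
      (signedPermIsometry_injective.comp hF_injective)).symm⟩

lemma nonempty_mulEquiv_A (n : ℕ) :
    Nonempty (A n ≃* Unit ⋊[(1 : Perm (Fin (n + 1)) →* MulAut Unit)] Perm (Fin (n + 1))) := by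
  refine nonempty_reflectionGroup_mulEquiv 1 (Function.injective_of_subsingleton _) (by simp)
    (fun i j hij => ⟨i, j, hij, rfl⟩) (by simp [one_mem]) ?_
  rintro _ ⟨i, j, hij, rfl⟩
  exact ⟨1, swap i j, by rw [reflection_e_sub hij, map_one, map_one, one_mul]⟩

lemma nonempty_mulEquiv_D (n : ℕ) :
    Nonempty (D n ≃* evenSigns (Fin n) ⋊[evenSignAct (Fin n)] Perm (Fin n)) := by
  refine nonempty_reflectionGroup_mulEquiv (evenSigns (Fin n)).subtype Subtype.val_injective
    (fun _ _ => rfl) (fun i j hij => ⟨i, j, hij, .inl rfl⟩) (fun v => ?_) ?_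
  · refine mem_of_pairSign_mem (H := (reflectionGroup (rootsD n)).comap
      ((signedPermIsometry (Fin n)).comp (inl.comp (evenSigns (Fin n)).subtype)))
      (fun i j hij => ?_) v
    have h_add := reflection_mem_reflectionGroup (Φ := rootsD n) ⟨i, j, hij, .inr rfl⟩
    have h_sub := reflection_mem_reflectionGroup (Φ := rootsD n) ⟨i, j, hij, .inl rfl⟩
    rw [reflection_e_add hij, map_mul] at h_add
    rw [reflection_e_sub hij] at h_sub
    exact (Subgroup.mul_mem_cancel_right _ h_sub).mp h_add
  · rintro _ ⟨i, j, hij, rfl | rfl⟩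
    · exact ⟨1, swap i j, by rw [reflection_e_sub hij, map_one, map_one, one_mul]⟩
    · exact ⟨pairSign i j, swap i j, reflection_e_add hij⟩

lemma nonempty_mulEquiv_C (n : ℕ) :
    Nonempty (C n ≃* (Fin n → ℤˣ) ⋊[coordAct (Fin n) ℤˣ] Perm (Fin n)) := by
  refine nonempty_reflectionGroup_mulEquiv (MonoidHom.id _) Function.injective_id
    (fun _ _ => rfl) (fun i j hij => .inl ⟨i, j, hij, .inl rfl⟩) (fun v => ?_) ?_
  · refine Subgroup.pi_mem_of_mulSingle_mem (H := (reflectionGroup (rootsC n)).comap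
      ((signedPermIsometry (Fin n)).comp inl)) v fun i => ?_
    rw [Subgroup.mem_comap, MonoidHom.comp_apply]
    rcases Int.units_eq_one_or (v i) with h | h <;> rw [h]
    · rw [Pi.mulSingle_one, map_one, map_one]
      exact one_mem _
    · rw [← reflection_e]
      exact reflection_mem_reflectionGroup (.inr ⟨i, rfl⟩)
  · rintro _ (⟨i, j, hij, rfl | rfl⟩ | ⟨i, rfl⟩)
    · exact ⟨1, swap i j, by rw [reflection_e_sub hij, map_one, map_one, one_mul]⟩
    · exact ⟨pairSign i j, swap i j, reflection_e_add hij⟩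
    · exact ⟨Pi.mulSingle i (-1), 1, by rw [reflection_e, map_one, mul_one, MonoidHom.id_apply]⟩

end Geometry

section Congr

lemma probAut_congr {G H : Type*} [Group G] [Group H] (f : G ≃* H) : probAut G = probAut H := by
  let F : (G →* G) ≃ (H →* H) := f.monoidHomCongrLeftEquiv.trans f.monoidHomCongrRightEquiv
  have h_bijective (φ : G →* G) : Function.Bijective φ ↔ Function.Bijective (F φ) := by
    change _ ↔ Function.Bijective (f ∘ φ ∘ f.symm)
    rw [f.bijective.of_comp_iff', Function.Bijective.of_comp_iff _ f.symm.bijective]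
  rw [probAut, probAut, Nat.card_congr F,
    Nat.card_congr (F.subtypeEquiv (q := fun ψ : H →* H => Function.Bijective ψ) h_bijective)]

lemma probAut_A (n : ℕ) : probAut (A n) =
    probAut (Unit ⋊[(1 : Perm (Fin (n + 1)) →* MulAut Unit)] Perm (Fin (n + 1))) :=
  (nonempty_mulEquiv_A n).elim probAut_congr

lemma probAut_D (n : ℕ) : probAut (D n) =
    probAut (evenSigns (Fin n) ⋊[evenSignAct (Fin n)] Perm (Fin n)) :=
  (nonempty_mulEquiv_D n).elim probAut_congr

lemma probAut_C (n : ℕ) : probAut (C n) =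
    probAut ((Fin n → ℤˣ) ⋊[coordAct (Fin n) ℤˣ] Perm (Fin n)) :=
  (nonempty_mulEquiv_C n).elim probAut_congr

lemma tendsto_probAut_C_of_ite_eq {k : ℕ → ℕ} (hk : Tendsto k atTop atTop) {c : ℝ}
    (hc : ∀ n, (if Even (k n) then 1 / 2 else 1 / 4) = c) :
    Tendsto (fun n => probAut (C (k n))) atTop (𝓝 c) := by
  rw [← tendsto_sub_nhds_zero_iff]
  simpa only [Function.comp_def, hc, probAut_C] using tendsto_probAut_signs_sub_ite.comp hk

end Congr

end ReflectionGroups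

theorem theorem4 :
    Tendsto (fun n : ℕ => ReflectionGroups.probAut (ReflectionGroups.C (2 * n)))
      atTop (𝓝 (1 / 2)) ∧
    Tendsto (fun n : ℕ => ReflectionGroups.probAut (ReflectionGroups.D n))
      atTop (𝓝 (1 / 2)) ∧
    Tendsto (fun n : ℕ => ReflectionGroups.probAut (ReflectionGroups.C (2 * n + 1)))
      atTop (𝓝 (1 / 4)) ∧
    Tendsto (fun n : ℕ => ReflectionGroups.probAut (ReflectionGroups.A n))
      atTop (𝓝 1) := by
  have h_double : Tendsto (fun n : ℕ => 2 * n) atTop atTop :=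
    tendsto_id.const_mul_atTop' two_pos
  refine ⟨?_, ?_, ?_, ?_⟩
  · exact ReflectionGroups.tendsto_probAut_C_of_ite_eq h_double fun n => if_pos (by simp)
  · simpa only [ReflectionGroups.probAut_D] using ReflectionGroups.tendsto_probAut_evenSigns
  · exact ReflectionGroups.tendsto_probAut_C_of_ite_eq ((tendsto_add_atTop_nat 1).comp h_double)
      fun n => if_neg (by simp)
  · simpa only [Function.comp_def, ReflectionGroups.probAut_A] using
      ReflectionGroups.tendsto_probAut_unit_perm.comp (tendsto_add_atTop_nat 1)
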